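/- Let $d\ge 1$, let $\zeta$ be a random variable with law $P$, let $f(x,\zeta)$, $x\in\mathbb R^d$, be real valued with $\mathbb E|f(x,\zeta)|<\infty$, and let $F(x)=\mathbb E_\zeta[f(x,\zeta)]$. Assume: (1) $F$ is $C^2$ and bounded below, and for every $\zeta$ the function $f(\cdot,\zeta)$ is $C^2$ with $\|\nabla f(x,\zeta)-\nabla f(y,\zeta)\|\le L_f\|x-y\|$ and $\|\nabla^2 f(x,\zeta)-\nabla^2 f(y,\zeta)\|\le M_f\|x-y\|$ for all $x,y$. (2) There are $\beta_1,\beta_2\ge 0$ with $\mathbb E_\zeta\|\nabla f(x,\zeta)-\nabla F(x)\|^2\le\beta_1\|\nabla F(x)\|^2+\beta_2$ for all $x$. Fix $\nu>0$, $\theta>0$, a starting point $x_0\in\mathbb R^d$, and deterministic step sizes $\alpha_k$ and numbers of directions $|T_k|\ge 1$. For a finite sample $S$ and a finite family of directions $T$ put $F_S=\frac1{|S|}\sum_{\zeta_i\in S}f(\cdot,\zeta_i)$ and $$g_{S,T}(x)=\gamma\sum_{u\in T}\frac{F_S(x+\nu u)-F_S(x-\nu u)}{2\nu}\,u ,\qquad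 x_{k+1}=x_k-\alpha_k\,g_{S_k,T_k}(x_k)\quad(k\ge 0),$$ and write $g_{\zeta,T}$ for $g_{\{\zeta\},T}$. One of the following methods is used at all iterations: cFD: $T_k=\{e_1,\dots,e_d\}$, $\gamma=1$; cGS: $T_k$ consists of independent $\mathcal N(0,I)$ vectors, $\gamma=1/|T_k|$; cSS: $T_k$ consists of independent vectors uniform on the unit sphere, $\gamma=d/|T_k|$; cRC: $T_k$ is a uniformly random set of $|T_k|$ distinct canonical vectors, $\gamma=d/|T_k|$; cRS: $T_k$ consists of random orthonormal vectors with $\mathbb E\big[\sum_{u\in T_k}uu^T\big]=\frac{|T_k|}{d}I$ (for instance a uniformly distributed orthonormal frame, or a uniformly random subset of a random orthonormal basis), $\gamma=d/|T_k|$. Let $\mathcal F_k$ be the $\sigma$-algebra generated by $T_j,S_j$ for $0\le j<k$, let $\mathcal F_{k+1/2}$ be generated by $\mathcal F_k$ and $T_k$, and write $\mathbb E_k=\mathbb E_{T_k}=\mathbb E[\,\cdot\mid\mathcal F_k]$ and $g_{T_k}(x_k)=\mathbb E[g_{S_k,T_k}(x_k)\mid\mathcal F_{k+1/2}]$. Assume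 (3) $T_k$ is independent of $\mathcal F_k$, the size $|S_k|\ge1$ is $\mathcal F_k$-measurable, and conditionally on $\mathcal F_{k+1/2}$ the set $S_k$ consists of $|S_k|$ i.i.d. samples of $\zeta$. Then $\nabla F$ and $\nabla^2F$ are Lipschitz with constants $L_f$ and $M_f$. Moreover, let $L_F>0$ and $M_F$ be any Lipschitz constants of $\nabla F$ and $\nabla^2F$, and put $\Omega_1=\frac{1}{4(1+\theta^2)L_F}$ and $\Omega_2=\frac{dM_F^2\nu^4}{48}$. Let $k\ge 0$ be such that the norm condition $$\frac{\mathbb E_{T_k}\big[\mathbb E_\zeta\|g_{\zeta,T_k}(x_k)-g_{T_k}(x_k)\|^2\big]}{|S_k|}\le\theta^2\,\mathbb E_{T_k}\|g_{T_k}(x_k)\|^2\quad\text{a.s.}$$ holds. If $0<\alpha_k\le\bar\alpha_k$, then $F(x_{k+1})$ is integrable and almost surely $$\mathbb E_k[F(x_{k+1})]\le F(x_k)-\frac{\alpha_k}{4}\|\nabla F(x_k)\|^2+\alpha_k\chi_k ,$$ where cFD: $\bar\alpha_k=\Omega_1$, $\chi_k=\Omega_2$; cGS: $\bar\alpha_k=\frac{|T_k|}{|T_k|+4.5d}\Omega_1$,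 $\chi_k=\frac{72|T_k|d+216d^2+(d+2)(d+4)(d+6)}{2(|T_k|+4.5d)}\Omega_2$; cSS: $\bar\alpha_k=\frac{|T_k|}{|T_k|+4.5d}\Omega_1$, $\chi_k=\frac{72|T_k|+216d+d^2}{2d(|T_k|+4.5d)}\Omega_2$; cRC and cRS: $\bar\alpha_k=\frac{|T_k|}{d}\Omega_1$, $\chi_k=\Omega_2$. Here $\bar\alpha_k>0$, and $\chi_k>0$ whenever $M_F>0$. -/

import Mathlib

open MeasureTheory ProbabilityTheory

namespace CFD

noncomputable section

/-- The space `ℝ^d` with the Euclidean norm. -/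
abbrev Vec (d : ℕ) : Type := EuclideanSpace ℝ (Fin d)

/-- The Hessian `∇²φ(x)`, as a linear operator; its norm is the spectral norm. -/
def hessian {d : ℕ} (φ : Vec d → ℝ) (x : Vec d) : Vec d →L[ℝ] Vec d :=
  fderiv ℝ (gradient φ) x

/-- `L` is a Lipschitz constant of the gradient of `φ`. -/
def GradLipschitz {d : ℕ} (φ : Vec d → ℝ) (L : ℝ) : Prop :=
  ∀ x y, ‖gradient φ x - gradient φ y‖ ≤ L * ‖x - y‖

/-- `M` is a Lipschitz constant of the Hessian of `φ`. -/
def HessLipschitz {d : ℕ} (φ : Vec d → ℝ) (M : ℝ) : Prop :=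
  ∀ x y, ‖hessian φ x - hessian φ y‖ ≤ M * ‖x - y‖

section Objective

variable {d : ℕ} {Ξ : Type*} [MeasurableSpace Ξ]

/-- The objective `F(x) = 𝔼_ζ[f(x, ζ)]`, where `ζ` has law `P`. -/
def objective (P : Measure Ξ) (f : Vec d → Ξ → ℝ) (x : Vec d) : ℝ :=
  ∫ ζ, f x ζ ∂P

/-- The objective is well defined: `f(x, ζ)` is a random variable with finite expectation. -/
structure WellPosed (P : Measure Ξ) (f : Vec d → Ξ → ℝ) : Prop where
  measurable : ∀ x, Measurable (f x)
  integrable : ∀ x, Integrable (f x) P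

/-- Smoothness: `F` is `C²` and bounded below; each `f(·, ζ)` is `C²` with `Lf`-Lipschitz gradient
and `Mf`-Lipschitz Hessian. -/
structure Smoothness (P : Measure Ξ) (f : Vec d → Ξ → ℝ) (Lf Mf : ℝ) : Prop where
  contDiff_objective : ContDiff ℝ 2 (objective P f)
  bddBelow_objective : BddBelow (Set.range (objective P f))
  contDiff : ∀ ζ, ContDiff ℝ 2 (fun x => f x ζ)
  gradLipschitz : ∀ ζ, GradLipschitz (fun x => f x ζ) Lf
  hessLipschitz : ∀ ζ, HessLipschitz (fun x => f x ζ) Mf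

/-- Bounded variance of the stochastic gradients. -/
def BoundedVariance (P : Measure Ξ) (f : Vec d → Ξ → ℝ) : Prop :=
  ∃ β₁ β₂ : ℝ, 0 ≤ β₁ ∧ 0 ≤ β₂ ∧ ∀ x,
    Integrable (fun ζ => ‖gradient (fun y => f y ζ) x - gradient (objective P f) x‖ ^ 2) P ∧
    ∫ ζ, ‖gradient (fun y => f y ζ) x - gradient (objective P f) x‖ ^ 2 ∂P
      ≤ β₁ * ‖gradient (objective P f) x‖ ^ 2 + β₂

end Objective

/-- The five central finite-difference schemes: standard, Gaussian smoothing, sphere smoothing,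
randomized coordinate, randomized subspace. -/
inductive Scheme
  | cFD
  | cGS
  | cSS
  | cRC
  | cRS

/-- The canonical basis vector `e_j`. -/
def stdVec {d : ℕ} (j : Fin d) : Vec d := EuclideanSpace.single j 1

/-- The uniform probability measure on the unit sphere of `ℝ^d`, as a measure on `ℝ^d`. -/
def sphereUniform (d : ℕ) : Measure (Vec d) :=
  (((volume : Measure (Vec d)).toSphere Set.univ)⁻¹ •
    (volume : Measure (Vec d)).toSphere).map Subtype.val

/-- `τ` is the law of the tuple `T = (u_1, …, u_N)` of directions used by the scheme:
* cFD: `T = (e_1, …, e_d)`, deterministically;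
* cGS: `N` independent standard Gaussian vectors;
* cSS: `N` independent vectors uniform on the unit sphere;
* cRC: `N` distinct canonical vectors, chosen uniformly at random (without replacement);
* cRS: `N` random orthonormal vectors, isotropic in the sense that `𝔼[∑ u_j u_jᵀ] = (N/d) I`
  (in particular, uniformly distributed orthonormal `N`-frames, and uniformly chosen `N`-subsets
  of any random orthonormal basis). -/
def IsDirectionLaw (m : Scheme) {d N : ℕ} (τ : Measure (Fin N → Vec d)) : Prop :=
  match m with
  | .cFD => ∃ h : N = d, τ = Measure.dirac (fun j => stdVec (Fin.cast h j))
  | .cGS => τ = Measure.pi (fun _ => stdGaussian (Vec d))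
  | .cSS => τ = Measure.pi (fun _ => sphereUniform d)
  | .cRC => τ = (Fintype.card (Fin N ↪ Fin d) : ENNReal)⁻¹ •
      ∑ e : Fin N ↪ Fin d, Measure.dirac (fun j => stdVec (e j))
  | .cRS => (∀ᵐ u ∂τ, Orthonormal ℝ u) ∧
      ∀ v : Vec d, ∫ u, ∑ j, (inner ℝ (u j) v) ^ 2 ∂τ = (N : ℝ) / d * ‖v‖ ^ 2

/-- The scaling coefficient `γ` of the estimator in dimension `d` with `N` directions. -/
def scaling (m : Scheme) (d N : ℕ) : ℝ :=
  match m with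
  | .cFD => 1
  | .cGS => 1 / N
  | .cSS => d / N
  | .cRC => d / N
  | .cRS => d / N

/-- `Ω₁ = 1 / (4 (1 + θ²) L)`. -/
def Omega₁ (θ L : ℝ) : ℝ := 1 / (4 * (1 + θ ^ 2) * L)

/-- `Ω₂ = d M² ν⁴ / 48`. -/
def Omega₂ (d : ℕ) (M ν : ℝ) : ℝ := d * M ^ 2 * ν ^ 4 / 48

/-- The step size bound `ᾱ`. -/
def alphaBar (m : Scheme) (d N : ℕ) (θ L : ℝ) : ℝ :=
  match m with
  | .cFD => Omega₁ θ L
  | .cGS => N / (N + 4.5 * d) * Omega₁ θ L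
  | .cSS => N / (N + 4.5 * d) * Omega₁ θ L
  | .cRC => N / d * Omega₁ θ L
  | .cRS => N / d * Omega₁ θ L

/-- The error term `χ`. -/
def chi (m : Scheme) (d N : ℕ) (M ν : ℝ) : ℝ :=
  match m with
  | .cFD => Omega₂ d M ν
  | .cGS => (72 * N * d + 216 * d ^ 2 + (d + 2) * (d + 4) * (d + 6)) / (2 * (N + 4.5 * d))
      * Omega₂ d M ν
  | .cSS => (72 * N + 216 * d + d ^ 2) / (2 * d * (N + 4.5 * d)) * Omega₂ d M ν
  | .cRC => Omega₂ d M ν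
  | .cRS => Omega₂ d M ν

/-- The central finite-difference gradient estimator of `φ` at `x` along `u_1, …, u_N`:
`γ ∑_j (φ(x + ν u_j) - φ(x - ν u_j)) / (2 ν) • u_j`. -/
def gradEst {d N : ℕ} (φ : Vec d → ℝ) (ν γ : ℝ) (u : Fin N → Vec d) (x : Vec d) : Vec d :=
  γ • ∑ j, ((φ (x + ν • u j) - φ (x - ν • u j)) / (2 * ν)) • u j

/-- A finite sample `(ζ_1, …, ζ_n)` of random size `n`. -/
abbrev Sample (Ξ : Type*) : Type _ := Σ n : ℕ, (Fin n → Ξ)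

/-- The subsampled function `F_S(x) = (1/|S|) ∑_{ζ ∈ S} f(x, ζ)`. -/
def subsampled {d : ℕ} {Ξ : Type*} (f : Vec d → Ξ → ℝ) (s : Sample Ξ) (x : Vec d) : ℝ :=
  (1 / (s.1 : ℝ)) * ∑ i, f x (s.2 i)

section Iteration

variable {d : ℕ} {Ω Ξ : Type*} [MeasurableSpace Ω] [MeasurableSpace Ξ] {N : ℕ → ℕ}

/-- The iterates `x_{k+1} = x_k - α_k g_{S_k,T_k}(x_k)`, started at the given point `x₀`. -/
def iter (m : Scheme) (f : Vec d → Ξ → ℝ) (ν : ℝ) (α : ℕ → ℝ)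
    (T : (k : ℕ) → Ω → Fin (N k) → Vec d) (S : ℕ → Ω → Sample Ξ) (x₀ : Vec d) :
    ℕ → Ω → Vec d
  | 0, _ => x₀
  | k + 1, ω => iter m f ν α T S x₀ k ω - α k •
      gradEst (subsampled f (S k ω)) ν (scaling m d (N k)) (T k ω) (iter m f ν α T S x₀ k ω)

/-- `ℱ_k`: the σ-algebra generated by the directions and samples of the iterations before `k`. -/
abbrev past (T : (k : ℕ) → Ω → Fin (N k) → Vec d) (S : ℕ → Ω → Sample Ξ) (k : ℕ) :
    MeasurableSpace Ω :=
  ⨆ j : Fin k, (MeasurableSpace.comap (T j) inferInstance ⊔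
    MeasurableSpace.comap (S j) inferInstance)

/-- `ℱ_{k+1/2}`: the σ-algebra generated by `ℱ_k` and the directions of iteration `k`. -/
abbrev pastHalf (T : (k : ℕ) → Ω → Fin (N k) → Vec d) (S : ℕ → Ω → Sample Ξ) (k : ℕ) :
    MeasurableSpace Ω :=
  past T S k ⊔ MeasurableSpace.comap (T k) inferInstance

/-- The sampling scheme: at iteration `k`, the directions `T_k` are drawn independently of the past
from the law of the method; the sample size `|S_k| ≥ 1` is determined by the past; and,
conditionally on the past and on `T_k`, the elements of `S_k` are `|S_k|` independent draws
from `P`. -/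
structure Sampling (μ : Measure Ω) (P : Measure Ξ) (m : Scheme)
    (T : (k : ℕ) → Ω → Fin (N k) → Vec d) (S : ℕ → Ω → Sample Ξ) : Prop where
  measurable_T : ∀ k, Measurable (T k)
  measurable_S : ∀ k, Measurable (S k)
  law_T : ∀ k, IsDirectionLaw m (μ.map (T k))
  indep_T : ∀ k, Indep (MeasurableSpace.comap (T k) inferInstance) (past T S k) μ
  size_pos : ∀ k ω, 1 ≤ (S k ω).1
  size_past : ∀ k, Measurable[past T S k] (fun ω => (S k ω).1)
  iid_S : ∀ k n, ∀ B : Set Ω, MeasurableSet[pastHalf T S k] B →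
    ∀ A : Set (Fin n → Ξ), MeasurableSet A →
      μ (B ∩ {ω | ∃ z ∈ A, S k ω = ⟨n, z⟩})
        = μ (B ∩ {ω | (S k ω).1 = n}) * Measure.pi (fun _ : Fin n => P) A

/-- `g_{T_k}(x_k) = 𝔼_{S_k}[g_{S_k,T_k}(x_k)]`, where `𝔼_{S_k} = 𝔼[· | ℱ_{k+1/2}]`. -/
def gT (μ : Measure Ω) (m : Scheme) (f : Vec d → Ξ → ℝ) (ν : ℝ) (α : ℕ → ℝ)
    (T : (k : ℕ) → Ω → Fin (N k) → Vec d) (S : ℕ → Ω → Sample Ξ) (x₀ : Vec d) (k : ℕ) :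
    Ω → Vec d :=
  μ[fun ω => gradEst (subsampled f (S k ω)) ν (scaling m d (N k)) (T k ω)
      (iter m f ν α T S x₀ k ω) | pastHalf T S k]

/-- The theoretical norm condition at iteration `k`:
`𝔼_{T_k}[𝔼_ζ[‖g_{ζ,T_k}(x_k) - g_{T_k}(x_k)‖²]] / |S_k| ≤ θ² 𝔼_{T_k}[‖g_{T_k}(x_k)‖²]` a.s.,
where `𝔼_{T_k} = 𝔼[· | ℱ_k]`. -/
def NormCondition (μ : Measure Ω) (P : Measure Ξ) (m : Scheme) (f : Vec d → Ξ → ℝ) (ν : ℝ)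
    (α : ℕ → ℝ) (T : (k : ℕ) → Ω → Fin (N k) → Vec d) (S : ℕ → Ω → Sample Ξ) (x₀ : Vec d)
    (θ : ℝ) (k : ℕ) : Prop :=
  ∀ᵐ ω ∂μ,
    (μ[fun ω' => ∫ ζ, ‖gradEst (fun y => f y ζ) ν (scaling m d (N k)) (T k ω')
          (iter m f ν α T S x₀ k ω') - gT μ m f ν α T S x₀ k ω'‖ ^ 2 ∂P | past T S k]) ω
        / ((S k ω).1 : ℝ)
      ≤ θ ^ 2 * (μ[fun ω' => ‖gT μ m f ν α T S x₀ k ω'‖ ^ 2 | past T S k]) ω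

end Iteration

end

end CFD

open MeasureTheory ProbabilityTheory


/-! Write `F` for the objective, `a = ∇F(x_k)`, `e` for the estimator used in the step and `G` for
the same estimator with `F` in place of the subsampled function. The descent lemma bounds
`F(x_{k+1})` by `F(x_k) - α ⟨a, e⟩ + (LF α² / 2) ‖e‖²`. Averaging over the sample replaces `e` by
`G` in the linear term and `‖e‖²` by `‖G‖² + Var/|S_k|`. After averaging over the directions, the
norm condition bounds the variance term by `θ²` times the second moment of `G`, and the step size
bound gives `LF α² (1 + θ²) / 2 ≤ α c / 8` with `c = ᾱ / Ω₁` (`stepFactor`). What remains is a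
statement about the direction law at a fixed point: `𝔼[-⟨a, G⟩ + (c/8) ‖G‖²] ≤ -‖a‖²/4 + χ`, which
is `IsDirectionLaw.integral_descent_le`.

For this, `G = γ ∑ (⟨a, u_j⟩ + h(u_j)) u_j`, where `h = diffErr` is the error of the central
difference. The Lipschitz Hessian gives `|h(u)| ≤ M ν² ‖u‖³ / 6` and a matching oscillation bound.
For orthonormal directions (cFD, cRC, cRS) the square of the sum splits into the directions, the
estimate is pointwise in each, and isotropy turns `∑ ⟨u_j, a⟩²` into a multiple of `‖a‖²`
(`integral_descent_le_of_orthonormal`). For independent directions (cGS, cSS) the first two moments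
of one summand decide (`integral_descent_le_of_iid`).

The delicate point there is the bias. Bounding `𝔼[h(u) u]` by norms alone loses a factor of order
`d`. Both laws are invariant under reflections, so only the part of `h` that is odd under the
reflection in `v^⊥` contributes to the component along `v`. The oscillation bound then produces a
second factor `⟨u, v⟩`, and isotropy recovers the dimension (`abs_integral_mul_inner_le`).

Conditional expectations are handled through integrals over events of the past: the joint law of
past data and sample is a composition with a kernel, that of past data and directions is a product.
Square integrability of the iterates, obtained by induction, makes all these integrals legitimate.
-/

namespace CFD

/-! ### Taylor estimates and the error of the central difference quotient. -/

section Calculus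

variable {d : ℕ} {φ : Vec d → ℝ}

/-- If `‖p' t‖ ≤ c tⁿ` on `[0, 1]` and `p 0 = 0`, then `‖p 1‖ ≤ c / (n + 1)`. -/
lemma norm_apply_one_le_of_deriv_le_pow {E : Type*} [NormedAddCommGroup E] [NormedSpace ℝ E]
    {p p' : ℝ → E} (n : ℕ) (c : ℝ) (h0 : p 0 = 0) (hp : ∀ t, HasDerivAt p (p' t) t)
    (hb : ∀ t, 0 ≤ t → ‖p' t‖ ≤ c * t ^ n) : ‖p 1‖ ≤ c / (n + 1) := by
  have hn : (n : ℝ) + 1 ≠ 0 := by positivity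
  have hB : ∀ t : ℝ, HasDerivAt (fun t : ℝ => c / (n + 1) * t ^ (n + 1)) (c * t ^ n) t := by
    intro t
    refine ((hasDerivAt_pow (n + 1) t).const_mul (c / (n + 1))).congr_deriv ?_
    push_cast
    field_simp
  have := image_norm_le_of_norm_deriv_right_le_deriv_boundary (a := 0) (b := 1) (f := p) (f' := p')
    (fun t _ => (hp t).continuousAt.continuousWithinAt)
    (fun t _ => (hp t).hasDerivWithinAt) (B := fun t : ℝ => c / (n + 1) * t ^ (n + 1))
    (B' := fun t => c * t ^ n) (by simp [h0]) hB (fun t ht => hb t ht.1)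
    (x := 1) (by simp)
  simpa using this

lemma GradLipschitz.nonneg (hd : 1 ≤ d) {L : ℝ} (h : GradLipschitz φ L) : 0 ≤ L := by
  have h1 := (norm_nonneg _).trans (h (stdVec ⟨0, hd⟩) 0)
  simpa [stdVec] using h1

lemma HessLipschitz.nonneg (hd : 1 ≤ d) {M : ℝ} (h : HessLipschitz φ M) : 0 ≤ M := by
  have h1 := (norm_nonneg _).trans (h (stdVec ⟨0, hd⟩) 0)
  simpa [stdVec] using h1

lemma hasGradientAt_of_contDiff (hφ : ContDiff ℝ 2 φ) (x : Vec d) :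
    HasGradientAt φ (gradient φ x) x :=
  (hφ.differentiable (by norm_num) x).hasGradientAt

lemma contDiff_gradient (hφ : ContDiff ℝ 2 φ) : ContDiff ℝ 1 (gradient φ) :=
  (InnerProductSpace.toDual ℝ (Vec d)).symm.contDiff.comp
    (hφ.fderiv_right (m := 1) (by norm_num))

lemma hasFDerivAt_gradient (hφ : ContDiff ℝ 2 φ) (x : Vec d) :
    HasFDerivAt (gradient φ) (hessian φ x) x :=
  ((contDiff_gradient hφ).differentiable (by norm_num) x).hasFDerivAt

lemma hasDerivAt_comp_line (hφ : ContDiff ℝ 2 φ) (x v : Vec d) (t : ℝ) :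
    HasDerivAt (fun t : ℝ => φ (x + t • v)) (inner ℝ (gradient φ (x + t • v)) v) t := by
  have h1 : HasDerivAt (fun t : ℝ => x + t • v) v t := by
    simpa using ((hasDerivAt_id t).smul_const v).const_add x
  simpa [Function.comp_def] using (hasGradientAt_of_contDiff hφ (x + t • v)).hasFDerivAt.comp_hasDerivAt t h1

lemma hasDerivAt_gradient_comp_line (hφ : ContDiff ℝ 2 φ) (x v : Vec d) (t : ℝ) :
    HasDerivAt (fun t : ℝ => gradient φ (x + t • v)) (hessian φ (x + t • v) v) t := by
  have h1 : HasDerivAt (fun t : ℝ => x + t • v) v t := by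
    simpa using ((hasDerivAt_id t).smul_const v).const_add x
  exact (hasFDerivAt_gradient hφ (x + t • v)).comp_hasDerivAt t h1

/-- The descent lemma. -/
lemma GradLipschitz.abs_sub_le (hφ : ContDiff ℝ 2 φ) {L : ℝ} (h : GradLipschitz φ L)
    (x v : Vec d) : |φ (x + v) - φ x - inner ℝ (gradient φ x) v| ≤ L / 2 * ‖v‖ ^ 2 := by
  have key := norm_apply_one_le_of_deriv_le_pow (E := ℝ) 1 (L * ‖v‖ ^ 2)
    (p := fun t => φ (x + t • v) - φ x - t * inner ℝ (gradient φ x) v)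
    (p' := fun t => inner ℝ (gradient φ (x + t • v)) v - inner ℝ (gradient φ x) v)
    (by simp) (fun t => by
      have h2 := ((hasDerivAt_comp_line hφ x v t).sub_const (φ x)).sub
        ((hasDerivAt_id t).mul_const (inner ℝ (gradient φ x) v))
      rw [one_mul] at h2
      exact h2)
    (fun t ht => by
      rw [← inner_sub_left]
      refine (norm_inner_le_norm _ _).trans ?_
      have := h (x + t • v) x
      rw [add_sub_cancel_left, norm_smul, Real.norm_of_nonneg ht] at this
      calc _ ≤ L * (t * ‖v‖) * ‖v‖ := by gcongr
        _ = _ := by ring)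
  simp only [Real.norm_eq_abs, one_smul, one_mul] at key
  refine key.trans (le_of_eq ?_)
  norm_num
  ring

/-- The first-order terms cancel in the symmetric second difference: its derivative along the
segment is `(∇²φ(x + tz) - ∇²φ(x - tz)) z`, of size at most `2 M t ‖z‖²`. -/
lemma HessLipschitz.norm_gradient_symm_le (hφ : ContDiff ℝ 2 φ) {M : ℝ}
    (h : HessLipschitz φ M) (x z : Vec d) :
    ‖gradient φ (x + z) + gradient φ (x - z) - (2 : ℝ) • gradient φ x‖ ≤ M * ‖z‖ ^ 2 := by
  have key := norm_apply_one_le_of_deriv_le_pow (E := Vec d) 1 (2 * M * ‖z‖ ^ 2)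
    (p := fun t => gradient φ (x + t • z) + gradient φ (x + t • (-z)) - (2 : ℝ) • gradient φ x)
    (p' := fun t => hessian φ (x + t • z) z + hessian φ (x + t • (-z)) (-z))
    (by simp [two_smul]) (fun t => ((hasDerivAt_gradient_comp_line hφ x z t).add
        (hasDerivAt_gradient_comp_line hφ x (-z) t)).sub_const _)
    (fun t ht => by
      rw [map_neg, ← sub_eq_add_neg, ← sub_apply]
      refine (ContinuousLinearMap.le_opNorm _ _).trans ?_
      have := h (x + t • z) (x + t • (-z))
      rw [add_sub_add_left_eq_sub, ← smul_sub, sub_neg_eq_add, ← two_smul ℝ z, smul_smul,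
        norm_smul, Real.norm_of_nonneg (by positivity)] at this
      calc _ ≤ M * (t * 2 * ‖z‖) * ‖z‖ := by gcongr
        _ = _ := by ring)
  simp only [one_smul, ← sub_eq_add_neg] at key
  refine key.trans (le_of_eq ?_)
  norm_num
  ring

/-- The error of the central difference quotient of `φ` at `x` in direction `u`. -/
noncomputable def diffErr (φ : Vec d → ℝ) (ν : ℝ) (x u : Vec d) : ℝ :=
  (φ (x + ν • u) - φ (x - ν • u)) / (2 * ν) - inner ℝ (gradient φ x) u

/-- Differentiation is in the direction `u`, not in the base point. The gradient is half a symmetric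
second difference of `gradient φ`, which makes both the size and the oscillation of the error
accessible. -/
lemma hasGradientAt_diffErr (hφ : ContDiff ℝ 2 φ) {ν : ℝ} (hν : 0 < ν) (x u : Vec d) :
    HasGradientAt (diffErr φ ν x) ((1 / 2 : ℝ) • (gradient φ (x + ν • u) + gradient φ (x - ν • u)
      - (2 : ℝ) • gradient φ x)) u := by
  rw [hasGradientAt_iff_hasFDerivAt]
  have e1 : HasFDerivAt (fun u : Vec d => x + ν • u) (ν • ContinuousLinearMap.id ℝ (Vec d)) u :=
    ((hasFDerivAt_id u).const_smul ν).const_add x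
  have e2 : HasFDerivAt (fun u : Vec d => x - ν • u) (-(ν • ContinuousLinearMap.id ℝ (Vec d))) u :=
    ((hasFDerivAt_id u).const_smul ν).const_sub x
  have h1 := (hasGradientAt_of_contDiff hφ (x + ν • u)).hasFDerivAt.comp u e1
  have h2 := (hasGradientAt_of_contDiff hφ (x - ν • u)).hasFDerivAt.comp u e2
  have h3 := ((h1.sub h2).const_mul ((2 * ν)⁻¹)).sub
    (InnerProductSpace.toDual ℝ (Vec d) (gradient φ x)).hasFDerivAt
  refine (h3.congr_fderiv ?_).congr_of_eventuallyEq (.of_forall fun y => ?_)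
  · ext w
    simp
    field_simp
  · simp [diffErr, div_eq_inv_mul]

lemma HessLipschitz.norm_gradient_diffErr_le (hφ : ContDiff ℝ 2 φ) {M : ℝ}
    (h : HessLipschitz φ M) {ν : ℝ} (hν : 0 < ν) (x u : Vec d) :
    ‖gradient (diffErr φ ν x) u‖ ≤ M * ν ^ 2 / 2 * ‖u‖ ^ 2 := by
  rw [(hasGradientAt_diffErr hφ hν x u).gradient, norm_smul]
  have := h.norm_gradient_symm_le hφ x (ν • u)
  rw [norm_smul, Real.norm_of_nonneg hν.le] at this
  norm_num
  linarith

/-- The error vanishes at `u = 0`; integrating the quadratic gradient bound along the ray to `u`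
divides the constant by three. -/
lemma HessLipschitz.abs_diffErr_le (hφ : ContDiff ℝ 2 φ) {M : ℝ}
    (h : HessLipschitz φ M) {ν : ℝ} (hν : 0 < ν) (x u : Vec d) :
    |diffErr φ ν x u| ≤ M * ν ^ 2 / 6 * ‖u‖ ^ 3 := by
  have key := norm_apply_one_le_of_deriv_le_pow (E := ℝ) 2 (M * ν ^ 2 / 2 * ‖u‖ ^ 3)
    (p := fun t => diffErr φ ν x (t • u))
    (p' := fun t => inner ℝ (gradient (diffErr φ ν x) (t • u)) u)
    (by simp [diffErr]) (fun t => by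
      have h1 : HasDerivAt (fun t : ℝ => t • u) u t := by
        simpa using (hasDerivAt_id t).smul_const u
      have h2 := (hasGradientAt_diffErr hφ hν x (t • u))
      rw [h2.gradient]
      exact h2.hasFDerivAt.comp_hasDerivAt t h1)
    (fun t ht => by
      refine (norm_inner_le_norm _ _).trans ?_
      have := h.norm_gradient_diffErr_le hφ hν x (t • u)
      rw [norm_smul, Real.norm_of_nonneg ht] at this
      calc _ ≤ M * ν ^ 2 / 2 * (t * ‖u‖) ^ 2 * ‖u‖ := by gcongr
        _ = _ := by ring)
  simp only [Real.norm_eq_abs, one_smul] at key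
  refine key.trans (le_of_eq ?_)
  norm_num
  ring

/-- Mean value inequality on the ball of radius `‖u‖`, which contains both points. It is applied
later with `u'` a reflection of `u`. -/
lemma HessLipschitz.abs_diffErr_sub_le (hφ : ContDiff ℝ 2 φ) {M : ℝ} (hM : 0 ≤ M)
    (h : HessLipschitz φ M) {ν : ℝ} (hν : 0 < ν) (x : Vec d) {u u' : Vec d} (hu : ‖u'‖ ≤ ‖u‖) :
    |diffErr φ ν x u - diffErr φ ν x u'| ≤ M * ν ^ 2 / 2 * ‖u‖ ^ 2 * ‖u - u'‖ := by
  have := (convex_closedBall (0 : Vec d) ‖u‖).norm_image_sub_le_of_norm_fderiv_le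
    (f := diffErr φ ν x) (𝕜 := ℝ) (C := M * ν ^ 2 / 2 * ‖u‖ ^ 2) (x := u') (y := u)
    (fun y _ => (hasGradientAt_diffErr hφ hν x y).differentiableAt)
    (fun y hy => by
      have h1 := (hasGradientAt_diffErr hφ hν x y).differentiableAt.hasGradientAt
      rw [h1.hasFDerivAt.fderiv, LinearIsometryEquiv.norm_map]
      refine (h.norm_gradient_diffErr_le hφ hν x y).trans ?_
      have : ‖y‖ ≤ ‖u‖ := by simpa using hy
      gcongr)
    (by simpa using hu) (by simp)
  simpa using this

lemma continuous_diffErr (hφ : ContDiff ℝ 2 φ) (ν : ℝ) (x : Vec d) :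
    Continuous (diffErr φ ν x) := by
  have := hφ.continuous
  unfold diffErr
  fun_prop

lemma GradLipschitz.norm_gradient_le {L : ℝ} (h : GradLipschitz φ L) (x : Vec d) :
    ‖gradient φ x‖ ≤ ‖gradient φ 0‖ + L * ‖x‖ := by
  have := h x 0
  rw [sub_zero] at this
  linarith [norm_le_norm_add_norm_sub' (gradient φ x) (gradient φ 0)]

/-- A bound on the whole quotient from the gradient alone, by the mean value inequality on the ball
around `x` through the two evaluation points. It serves integrability, not the descent constants. -/
lemma GradLipschitz.abs_symm_diff_le (hφ : ContDiff ℝ 2 φ) {L : ℝ} (hL : 0 ≤ L)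
    (h : GradLipschitz φ L) {ν : ℝ} (hν : 0 < ν) (x u : Vec d) :
    |(φ (x + ν • u) - φ (x - ν • u)) / (2 * ν)| ≤ (‖gradient φ x‖ + L * ν * ‖u‖) * ‖u‖ := by
  have := (convex_closedBall x (ν * ‖u‖)).norm_image_sub_le_of_norm_fderiv_le
    (f := φ) (𝕜 := ℝ) (C := ‖gradient φ x‖ + L * ν * ‖u‖) (x := x - ν • u) (y := x + ν • u)
    (fun y _ => hφ.differentiable (by norm_num) y)
    (fun y hy => by
      rw [(hasGradientAt_of_contDiff hφ y).hasFDerivAt.fderiv, LinearIsometryEquiv.norm_map]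
      have h1 := h y x
      have h2 : ‖y - x‖ ≤ ν * ‖u‖ := by simpa [dist_eq_norm] using hy
      have h3 := norm_le_norm_add_norm_sub' (gradient φ y) (gradient φ x)
      have : L * ‖y - x‖ ≤ L * (ν * ‖u‖) := by gcongr
      linarith)
    (by simp [norm_smul, abs_of_pos hν])
    (by simp [norm_smul, abs_of_pos hν])
  rw [show x + ν • u - (x - ν • u) = (2 * ν) • u by rw [mul_smul, two_smul]; abel, norm_smul,
    Real.norm_of_nonneg (by positivity : 0 ≤ 2 * ν), Real.norm_eq_abs] at this
  rw [abs_div, abs_of_pos (by positivity : 0 < 2 * ν), div_le_iff₀ (by positivity)]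
  linarith

end Calculus

/-! ### Lipschitz constants pass from the integrands to the objective. -/

section Objective

variable {d : ℕ} {Ξ : Type*} [MeasurableSpace Ξ] {P : Measure Ξ} [IsProbabilityMeasure P]
  {f : Vec d → Ξ → ℝ} {Lf Mf : ℝ}

/-- A uniform bound for a combination of shifted gradients of the `f(·, ζ)` holds for the
objective. -/
lemma Smoothness.norm_sum_gradient_objective_le (hf : WellPosed P f)
    (hs : Smoothness P f Lf Mf) {n : ℕ} (c : Fin n → ℝ) (p : Fin n → Vec d) {C : ℝ} (hC : 0 ≤ C)
    (hb : ∀ ζ w, ‖∑ i, c i • gradient (fun x => f x ζ) (p i + w)‖ ≤ C) :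
    ‖∑ i, c i • gradient (objective P f) (p i)‖ ≤ C := by
  have hgrad : ∀ {φ : Vec d → ℝ}, ContDiff ℝ 2 φ → ∀ w, HasFDerivAt
      (fun w => ∑ i, c i * φ (p i + w))
      (InnerProductSpace.toDual ℝ (Vec d) (∑ i, c i • gradient φ (p i + w))) w := by
    intro φ hφ w
    have h1 : ∀ i ∈ Finset.univ, HasFDerivAt (fun w => c i * φ (p i + w))
        (c i • InnerProductSpace.toDual ℝ (Vec d) (gradient φ (p i + w))) w := fun i _ =>
      ((hasFDerivAt_comp_add_left (p i)).2
        (hasGradientAt_of_contDiff hφ (p i + w)).hasFDerivAt).const_mul (c i)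
    refine (HasFDerivAt.fun_sum h1).congr_fderiv ?_
    simp only [map_sum, map_smulₛₗ, conj_trivial]
  have hpt : ∀ ζ w, |∑ i, c i * f (p i + w) ζ - ∑ i, c i * f (p i + 0) ζ| ≤ C * ‖w‖ := by
    intro ζ w
    have := convex_univ.norm_image_sub_le_of_norm_hasFDerivWithin_le (C := C) (x := (0 : Vec d))
      (y := w) (fun y _ => (hgrad (hs.contDiff ζ) y).hasFDerivWithinAt)
      (fun y _ => by rw [LinearIsometryEquiv.norm_map]; exact hb ζ y) trivial trivial
    simpa using this
  have hint : ∀ w, Integrable (fun ζ => ∑ i, c i * f (p i + w) ζ) P := fun w =>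
    integrable_finsetSum _ fun i _ => (hf.integrable _).const_mul _
  have hval : ∀ w, ∑ i, c i * objective P f (p i + w) = ∫ ζ, ∑ i, c i * f (p i + w) ζ ∂P := by
    intro w
    rw [integral_finsetSum _ fun i _ => (hf.integrable _).const_mul _]
    simp only [integral_const_mul, objective]
  -- No differentiation under the integral: increments of the combination are bounded uniformly in
  -- `ζ`, hence on average, and a function whose increments from a point are at most `C ‖w‖` has
  -- derivative of norm at most `C` there.
  have := (hgrad hs.contDiff_objective 0).le_of_lip' hC (.of_forall fun w => by
    rw [hval, hval, ← integral_sub (hint _) (hint _), sub_zero]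
    refine (norm_integral_le_of_norm_le_const (C := C * ‖w‖) (.of_forall fun ζ => hpt ζ w)).trans ?_
    simp)
  rw [LinearIsometryEquiv.norm_map] at this
  simpa using this

lemma Smoothness.gradLipschitz_objective (hd : 1 ≤ d) (hf : WellPosed P f)
    (hs : Smoothness P f Lf Mf) : GradLipschitz (objective P f) Lf := by
  intro x y
  obtain ⟨ζ⟩ : Nonempty Ξ := nonempty_of_isProbabilityMeasure P
  have hL := (hs.gradLipschitz ζ).nonneg hd
  have := hs.norm_sum_gradient_objective_le hf ![1, -1] ![x, y] (C := Lf * ‖x - y‖)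
    (by positivity) (fun ζ w => by
      have := hs.gradLipschitz ζ (x + w) (y + w)
      rw [add_sub_add_right_eq_sub] at this
      simpa [Fin.sum_univ_two, ← sub_eq_add_neg] using this)
  simpa [Fin.sum_univ_two, ← sub_eq_add_neg] using this

lemma Smoothness.hessLipschitz_objective (hd : 1 ≤ d) (hf : WellPosed P f)
    (hs : Smoothness P f Lf Mf) : HessLipschitz (objective P f) Mf := by
  intro x y
  obtain ⟨ζ⟩ : Nonempty Ξ := nonempty_of_isProbabilityMeasure P
  have hM := (hs.hessLipschitz ζ).nonneg hd
  have hder : ∀ {φ : Vec d → ℝ}, ContDiff ℝ 2 φ → ∀ w z, HasFDerivAt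
      (fun z => gradient φ (x + w + z) - gradient φ (y + w + z))
      (hessian φ (x + w + z) - hessian φ (y + w + z)) z := fun hφ w z =>
    ((hasFDerivAt_comp_add_left _).2 (hasFDerivAt_gradient hφ _)).sub
      ((hasFDerivAt_comp_add_left _).2 (hasFDerivAt_gradient hφ _))
  have hpt : ∀ z, ‖gradient (objective P f) (x + z) - gradient (objective P f) (y + z)
      - (gradient (objective P f) x - gradient (objective P f) y)‖ ≤ Mf * ‖x - y‖ * ‖z‖ := by
    intro z
    -- The increment of `∇F(x + ·) - ∇F(y + ·)` from `0` to `z` is a four-point combination of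
    -- gradients, so the Hessian bound reduces to the gradient lemma and the mean value inequality
    -- for each `ζ`.
    have := hs.norm_sum_gradient_objective_le hf ![1, -1, -1, 1] ![x + z, y + z, x, y]
      (C := Mf * ‖x - y‖ * ‖z‖) (by positivity) (fun ζ w => by
        have := convex_univ.norm_image_sub_le_of_norm_hasFDerivWithin_le (C := Mf * ‖x - y‖)
          (x := (0 : Vec d)) (y := z)
          (fun z _ => (hder (hs.contDiff ζ) w z).hasFDerivWithinAt) (fun z _ => by
            refine (hs.hessLipschitz ζ _ _).trans (le_of_eq ?_)
            congr 2
            abel) trivial trivial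
        rw [sub_zero] at this
        refine le_trans (le_of_eq ?_) this
        simp only [Fin.sum_univ_four, Matrix.cons_val, one_smul, neg_smul, add_zero]
        rw [add_right_comm x, add_right_comm y]
        congr 1
        abel)
    refine le_trans (le_of_eq ?_) this
    simp only [Fin.sum_univ_four, Matrix.cons_val, one_smul, neg_smul]
    congr 1
    abel
  have h0 := (hder hs.contDiff_objective 0 0).le_of_lip' (C := Mf * ‖x - y‖) (by positivity)
    (.of_forall fun z => by simpa using hpt z)
  simpa using h0

end Objective

end CFD

namespace CFD

/-! ### Second moment of sums of independent copies, for directions and for samples alike. -/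

section Independent

variable {d : ℕ}

/-- The second moment of a sum of `n` independent copies of `w`. -/
lemma integral_norm_sum_sq_pi {X : Type*} [MeasurableSpace X] {ρ : Measure X}
    [IsProbabilityMeasure ρ] {w : X → Vec d} (hw : MemLp w 2 ρ) (n : ℕ) :
    Integrable (fun u : Fin n → X => ‖∑ j, w (u j)‖ ^ 2) (Measure.pi fun _ => ρ) ∧
    ∫ u : Fin n → X, ‖∑ j, w (u j)‖ ^ 2 ∂(Measure.pi fun _ => ρ)
      = n * ∫ x, ‖w x‖ ^ 2 ∂ρ + n * (n - 1) * ‖∫ x, w x ∂ρ‖ ^ 2 := by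
  have hi : ∀ j : Fin n, MemLp (fun u : Fin n → X => w (u j)) 2 (Measure.pi fun _ => ρ) :=
    fun j => hw.comp_measurePreserving (measurePreserving_eval (fun _ : Fin n => ρ) j)
  have hind : iIndepFun (fun (j : Fin n) (u : Fin n → X) => w (u j)) (Measure.pi fun _ => ρ) :=
    iIndepFun_pi (fun _ => hw.1.aemeasurable)
  have hmean : ∀ j : Fin n, ∫ u : Fin n → X, w (u j) ∂(Measure.pi fun _ => ρ) = ∫ x, w x ∂ρ :=
    fun j => integral_comp_eval (μ := fun _ : Fin n => ρ) (i := j) hw.1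
  have hinner : ∀ i j : Fin n,
      ∫ u : Fin n → X, inner ℝ (w (u i)) (w (u j)) ∂(Measure.pi fun _ => ρ)
        = if i = j then ∫ x, ‖w x‖ ^ 2 ∂ρ else ‖∫ x, w x ∂ρ‖ ^ 2 := by
    intro i j
    split_ifs with h
    · subst h
      simp only [real_inner_self_eq_norm_sq]
      exact integral_comp_eval (μ := fun _ : Fin n => ρ) (i := i) (hw.1.norm.pow 2)
    · have := (hind.indepFun h).integral_bilin ((hi i).integrable (by norm_num))
        ((hi j).integrable (by norm_num)) (innerSL ℝ)
      simpa [hmean, innerSL_apply_apply ℝ] using this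
  have hexp : ∀ u : Fin n → X, ‖∑ j, w (u j)‖ ^ 2 = ∑ i, ∑ j, inner ℝ (w (u i)) (w (u j)) := by
    intro u
    rw [← real_inner_self_eq_norm_sq, sum_inner]
    simp only [inner_sum]
  have hint : ∀ i j : Fin n, Integrable (fun u : Fin n → X => inner ℝ (w (u i)) (w (u j)))
      (Measure.pi fun _ => ρ) := fun i j => ((hi i).norm.integrable_mul (hi j).norm).mono'
    ((hi i).1.inner (hi j).1) (.of_forall fun u => norm_inner_le_norm _ _)
  simp only [hexp]
  refine ⟨integrable_finsetSum _ fun i _ => integrable_finsetSum _ fun j _ => hint i j, ?_⟩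
  rw [integral_finsetSum _ fun i _ => integrable_finsetSum _ fun j _ => hint i j]
  simp only [integral_finsetSum _ fun j _ => hint _ j, hinner]
  have : ∀ i : Fin n, (∑ j, if i = j then ∫ x, ‖w x‖ ^ 2 ∂ρ else ‖∫ x, w x ∂ρ‖ ^ 2)
      = ∫ x, ‖w x‖ ^ 2 ∂ρ + (n - 1) * ‖∫ x, w x ∂ρ‖ ^ 2 := by
    intro i
    have h1 : ∀ j : Fin n, (if i = j then ∫ x, ‖w x‖ ^ 2 ∂ρ else ‖∫ x, w x ∂ρ‖ ^ 2)
        = ‖∫ x, w x ∂ρ‖ ^ 2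
          + if i = j then ∫ x, ‖w x‖ ^ 2 ∂ρ - ‖∫ x, w x ∂ρ‖ ^ 2 else 0 := by
      intro j; split_ifs <;> ring
    simp only [h1, Finset.sum_add_distrib, Finset.sum_ite_eq, Finset.mem_univ, if_true,
      Finset.sum_const, Finset.card_univ, Fintype.card_fin, nsmul_eq_mul]
    ring
  simp only [this, Finset.sum_const, Finset.card_univ, Fintype.card_fin, nsmul_eq_mul]
  ring

end Independent

/-! ### Moments of the standard Gaussian vector. -/

section Gaussian

lemma integrable_pow_gaussianReal (n : ℕ) : Integrable (fun x : ℝ => x ^ n) (gaussianReal 0 1) := by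
  have := (memLp_id_gaussianReal' (μ := 0) (v := 1) n (by simp)).integrable_norm_pow' 
  exact (integrable_norm_iff (by fun_prop)).1 (by simpa [norm_pow] using this)

/-- Integration by parts: `x` times the Gaussian density is the derivative of minus the density. -/
lemma integral_pow_add_two_gaussianReal (n : ℕ) :
    ∫ x : ℝ, x ^ (n + 2) ∂(gaussianReal 0 1) = (n + 1) * ∫ x : ℝ, x ^ n ∂(gaussianReal 0 1) := by
  have hint : ∀ n : ℕ, Integrable (fun x : ℝ => x ^ n * gaussianPDFReal 0 1 x) := by
    intro n
    have h := integrable_pow_gaussianReal n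
    rw [gaussianReal_of_var_ne_zero _ (by norm_num), gaussianPDF_def,
      integrable_withDensity_iff (by fun_prop) (by simp)] at h
    simpa [ENNReal.toReal_ofReal, gaussianPDFReal_nonneg] using h
  have hderiv : ∀ x : ℝ, HasDerivAt (fun x => -gaussianPDFReal 0 1 x)
      (x * gaussianPDFReal 0 1 x) x := by
    intro x
    unfold gaussianPDFReal
    have h1 : HasDerivAt (fun x : ℝ => -(x - 0) ^ 2 / (2 * ((1 : NNReal) : ℝ))) (-x) x := by
      have := (((hasDerivAt_id x).sub_const 0).pow 2).neg.div_const (2 * ((1 : NNReal) : ℝ))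
      refine this.congr_deriv ?_
      simp
      ring
    refine (h1.exp.const_mul _).neg.congr_deriv ?_
    ring
  have key := integral_mul_deriv_eq_deriv_mul_of_integrable (u := fun x : ℝ => x ^ (n + 1))
    (u' := fun x => (n + 1) * x ^ n) (v := fun x => -gaussianPDFReal 0 1 x)
    (v' := fun x => x * gaussianPDFReal 0 1 x)
    (fun x _ => by simpa using hasDerivAt_pow (n + 1) x) (fun x _ => hderiv x)
    ((hint (n + 2)).congr (.of_forall fun x => by simp only [Pi.mul_apply]; ring))
    (((hint n).const_mul (-(n + 1 : ℝ))).congr (.of_forall fun x => by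
      simp only [Pi.mul_apply]; ring))
    ((hint (n + 1)).neg.congr (.of_forall fun x => by simp only [Pi.mul_apply, Pi.neg_apply]; ring))
  rw [integral_gaussianReal_eq_integral_smul (by norm_num),
    integral_gaussianReal_eq_integral_smul (by norm_num), ← integral_const_mul]
  simp only [smul_eq_mul]
  calc ∫ x, gaussianPDFReal 0 1 x * x ^ (n + 2)
      = ∫ x, x ^ (n + 1) * (x * gaussianPDFReal 0 1 x) := by congr 1; ext x; ring
    _ = _ := by
      rw [key, ← integral_neg]
      congr 1; ext x; ring

/-- The moments of a chi-squared variable, indexed by the set of its summands. -/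
lemma integral_sum_sq_pow_gaussianReal {d : ℕ} (s : Finset (Fin d)) :
    (∀ k : ℕ, Integrable (fun x : Fin d → ℝ => (∑ i ∈ s, x i ^ 2) ^ k)
      (Measure.pi fun _ => gaussianReal 0 1)) ∧
    ∀ k ≤ 4, ∫ x : Fin d → ℝ, (∑ i ∈ s, x i ^ 2) ^ k ∂(Measure.pi fun _ => gaussianReal 0 1)
      = ∏ j ∈ Finset.range k, ((s.card : ℝ) + 2 * j) := by
  classical
  have hq : ∀ i : Fin d, ∀ k : ℕ, Integrable (fun x : Fin d → ℝ => (x i ^ 2) ^ k)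
      (Measure.pi fun _ => gaussianReal 0 1) := by
    intro i k
    simp only [← pow_mul]
    exact (measurePreserving_eval (fun _ : Fin d => gaussianReal 0 1) i).integrable_comp_of_integrable
      (integrable_pow_gaussianReal (2 * k))
  have hqv : ∀ i : Fin d, ∀ k : ℕ, ∫ x : Fin d → ℝ, (x i ^ 2) ^ k
      ∂(Measure.pi fun _ => gaussianReal 0 1) = ∫ x : ℝ, x ^ (2 * k) ∂(gaussianReal 0 1) := by
    intro i k
    simp only [← pow_mul]
    exact integral_comp_eval (μ := fun _ : Fin d => gaussianReal 0 1) (i := i)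
      (f := fun x => x ^ (2 * k)) (by fun_prop)
  have m0 : ∫ x : ℝ, x ^ (2 * 0) ∂(gaussianReal 0 1) = 1 := by simp
  have m1 : ∫ x : ℝ, x ^ (2 * 1) ∂(gaussianReal 0 1) = 1 := by
    rw [integral_pow_add_two_gaussianReal 0]; simp
  have m2 : ∫ x : ℝ, x ^ (2 * 2) ∂(gaussianReal 0 1) = 3 := by
    rw [integral_pow_add_two_gaussianReal 2, m1]; norm_num
  have m3 : ∫ x : ℝ, x ^ (2 * 3) ∂(gaussianReal 0 1) = 15 := by
    rw [integral_pow_add_two_gaussianReal 4, m2]; norm_num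
  have m4 : ∫ x : ℝ, x ^ (2 * 4) ∂(gaussianReal 0 1) = 105 := by
    rw [integral_pow_add_two_gaussianReal 6, m3]; norm_num
  have hind : iIndepFun (fun (i : Fin d) (x : Fin d → ℝ) => x i ^ 2)
      (Measure.pi fun _ => gaussianReal 0 1) :=
    iIndepFun_pi (X := fun _ (y : ℝ) => y ^ 2) (fun _ => by fun_prop)
  -- Adding one coordinate, the binomial theorem and independence express the new moments through
  -- the old ones and the moments `1, 1, 3, 15, 105` of a single coordinate. The closed form is then
  -- a polynomial identity for each `k ≤ 4`; the eighth moment of the norm is the highest one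
  -- required.
  induction s using Finset.induction_on with
  | empty =>
    refine ⟨fun k => by simp, fun k _ => ?_⟩
    cases k <;> simp [Finset.prod_range_succ']
  | insert a s ha ih =>
    have hI : IndepFun (fun x : Fin d → ℝ => ∑ i ∈ s, x i ^ 2) (fun x : Fin d → ℝ => x a ^ 2)
        (Measure.pi fun _ => gaussianReal 0 1) := by
      have := hind.indepFun_finsetSum_of_notMem (fun i => by fun_prop) ha
      convert this using 1
      ext x; simp
    have hIk : ∀ k l : ℕ, IndepFun (fun x : Fin d → ℝ => (∑ i ∈ s, x i ^ 2) ^ k)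
        (fun x : Fin d → ℝ => (x a ^ 2) ^ l) (Measure.pi fun _ => gaussianReal 0 1) := fun k l =>
      hI.comp (φ := fun y => y ^ k) (ψ := fun y => y ^ l) (by fun_prop) (by fun_prop)
    have hexp : ∀ k : ℕ, ∀ x : Fin d → ℝ, (∑ i ∈ insert a s, x i ^ 2) ^ k
        = ∑ m ∈ Finset.range (k + 1),
          ((∑ i ∈ s, x i ^ 2) ^ m * (x a ^ 2) ^ (k - m)) * (k.choose m : ℝ) := by
      intro k x
      rw [Finset.sum_insert ha, add_comm, add_pow]
    have hterm : ∀ k m : ℕ, Integrable (fun x : Fin d → ℝ =>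
        ((∑ i ∈ s, x i ^ 2) ^ m * (x a ^ 2) ^ (k - m)) * (k.choose m : ℝ))
        (Measure.pi fun _ => gaussianReal 0 1) := fun k m =>
      ((hIk m (k - m)).integrable_mul (ih.1 m) (hq a _)).mul_const _
    simp only [hexp]
    refine ⟨fun k => integrable_finsetSum _ fun m _ => hterm k m, fun k hk => ?_⟩
    rw [integral_finsetSum _ fun m _ => hterm k m]
    have hval : ∀ m ∈ Finset.range (k + 1), ∫ x : Fin d → ℝ,
        ((∑ i ∈ s, x i ^ 2) ^ m * (x a ^ 2) ^ (k - m)) * (k.choose m : ℝ)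
          ∂(Measure.pi fun _ => gaussianReal 0 1)
        = (∏ j ∈ Finset.range m, ((s.card : ℝ) + 2 * j))
          * (∫ x : ℝ, x ^ (2 * (k - m)) ∂(gaussianReal 0 1)) * (k.choose m : ℝ) := by
      intro m hm
      rw [integral_mul_const, (hIk m (k - m)).integral_fun_mul_eq_mul_integral (ih.1 m).1
        (hq a _).1, hqv, ih.2 m (by simp at hm; omega)]
    rw [Finset.sum_congr rfl hval, Finset.card_insert_of_notMem ha]
    interval_cases k
    · simp
    all_goals
      simp only [Finset.sum_range_succ, Finset.prod_range_succ, Finset.sum_range_zero,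
        Finset.prod_range_zero, Nat.reduceSub, m0, m1, m2, m3, m4]
      norm_num [Nat.choose]
      try ring

lemma integral_norm_pow_stdGaussian (d : ℕ) {k : ℕ} (hk : k ≤ 4) :
    ∫ u : Vec d, ‖u‖ ^ (2 * k) ∂(stdGaussian (Vec d))
      = ∏ j ∈ Finset.range k, ((d : ℝ) + 2 * j) := by
  rw [← map_pi_eq_stdGaussian, integral_map (by fun_prop) (by fun_prop)]
  have := (integral_sum_sq_pow_gaussianReal (d := d) Finset.univ).2 k hk
  rw [Finset.card_univ, Fintype.card_fin] at this
  rw [← this]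
  congr 1
  ext x
  rw [pow_mul, EuclideanSpace.real_norm_sq_eq]

lemma integrable_norm_pow_stdGaussian (d k : ℕ) :
    Integrable (fun u : Vec d => ‖u‖ ^ k) (stdGaussian (Vec d)) :=
  (IsGaussian.memLp_id (stdGaussian (Vec d)) k (by simp)).integrable_norm_pow'

end Gaussian

/-! ### The uniform law on the sphere and its invariance. -/

section Sphere

open scoped Pointwise

variable {d : ℕ}

lemma isProbabilityMeasure_sphereUniform (hd : 1 ≤ d) : IsProbabilityMeasure (sphereUniform d) := by
  have : Nontrivial (Vec d) := by
    have : Nonempty (Fin d) := ⟨⟨0, hd⟩⟩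
    infer_instance
  unfold sphereUniform
  have : IsProbabilityMeasure (((volume : Measure (Vec d)).toSphere Set.univ)⁻¹ •
    (volume : Measure (Vec d)).toSphere) := by
    constructor
    rw [Measure.smul_apply, smul_eq_mul]
    exact ENNReal.inv_mul_cancel (by
      rw [Ne, Measure.measure_univ_eq_zero]
      exact (volume : Measure (Vec d)).toSphere_ne_zero)
      (measure_ne_top _ _)
  exact Measure.isProbabilityMeasure_map (by fun_prop)

lemma ae_norm_eq_one_sphereUniform : ∀ᵐ u ∂(sphereUniform d), ‖u‖ = 1 := by
  unfold sphereUniform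
  rw [ae_map_iff (by fun_prop) (measurableSet_eq_fun (by fun_prop) (by fun_prop))]
  exact .of_forall fun u => by simp

/-- The spherical measure of a set is a multiple of the volume of the cone over it, and a linear
isometry carries cones to cones and preserves volume. -/
lemma map_sphereUniform (e : Vec d ≃ₗᵢ[ℝ] Vec d) :
    (sphereUniform d).map e = sphereUniform d := by
  have hmeas : Measurable e := e.continuous.measurable
  ext A hA
  rw [Measure.map_apply hmeas hA]
  unfold sphereUniform
  have hval : Measurable (Subtype.val : Metric.sphere (0 : Vec d) 1 → Vec d) := by fun_prop
  rw [Measure.map_apply hval (hmeas hA), Measure.map_apply hval hA, Measure.smul_apply,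
    Measure.smul_apply, Measure.toSphere_apply' _ (hval (hmeas hA)),
    Measure.toSphere_apply' _ (hval hA)]
  congr 2
  have : Set.Ioo (0 : ℝ) 1 • ((Subtype.val : Metric.sphere (0 : Vec d) 1 → Vec d) ''
      (Subtype.val ⁻¹' (e ⁻¹' A)))
      = e ⁻¹' (Set.Ioo (0 : ℝ) 1 • ((Subtype.val : Metric.sphere (0 : Vec d) 1 → Vec d) ''
        (Subtype.val ⁻¹' A))) := by
    ext x
    simp only [Set.mem_smul, Set.mem_image, Set.mem_preimage, Subtype.exists,
      mem_sphere_zero_iff_norm, exists_and_left, exists_prop]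
    constructor
    · rintro ⟨r, hr, y, ⟨z, hz, hz1, rfl⟩, rfl⟩
      exact ⟨r, hr, e z, ⟨e z, hz, by simpa using hz1, rfl⟩, by simp⟩
    · rintro ⟨r, hr, y, ⟨z, hz, hz1, rfl⟩, h⟩
      refine ⟨r, hr, e.symm z, ⟨e.symm z, by simpa using hz, by simpa using hz1, rfl⟩, ?_⟩
      rw [← map_smul, h]
      simp
  rw [this]
  exact (e.measurePreserving.measure_preimage_equiv (f := e.toMeasurableEquiv) _)

end Sphere

end CFD

namespace CFD

/-! ### Bias and second moment for rotation invariant directions. -/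

section Invariant

variable {d : ℕ} {ρ : Measure (Vec d)}

lemma integral_comp_isometry (hρ : ∀ e : Vec d ≃ₗᵢ[ℝ] Vec d, ρ.map e = ρ)
    (e : Vec d ≃ₗᵢ[ℝ] Vec d) {G : Type*} [NormedAddCommGroup G] [NormedSpace ℝ G]
    (φ : Vec d → G) : ∫ u, φ (e u) ∂ρ = ∫ u, φ u ∂ρ := by
  conv_rhs => rw [← hρ e]
  exact (e.toHomeomorph.measurableEmbedding.integral_map φ).symm

lemma abs_inner_pow_mul_le (u v : Vec d) (k : ℕ) :
    ‖‖u‖ ^ k * inner ℝ u v ^ 2‖ ≤ ‖v‖ ^ 2 * ‖u‖ ^ (k + 2) := by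
  rw [Real.norm_of_nonneg (by positivity), ← sq_abs (inner ℝ u v)]
  have := abs_real_inner_le_norm u v
  calc _ ≤ ‖u‖ ^ k * (‖u‖ * ‖v‖) ^ 2 := by gcongr
    _ = _ := by ring

lemma integrable_norm_pow_mul_inner_sq (hint : ∀ k : ℕ, Integrable (fun u : Vec d => ‖u‖ ^ k) ρ)
    (k : ℕ) (v : Vec d) : Integrable (fun u => ‖u‖ ^ k * inner ℝ u v ^ 2) ρ :=
  ((hint (k + 2)).const_mul (‖v‖ ^ 2)).mono' (by fun_prop)
    (.of_forall fun u => abs_inner_pow_mul_le u v k)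

/-- Isotropy of a rotation invariant measure. -/
lemma integral_norm_pow_mul_inner_sq (hd : 1 ≤ d)
    (hρ : ∀ e : Vec d ≃ₗᵢ[ℝ] Vec d, ρ.map e = ρ)
    (hint : ∀ k : ℕ, Integrable (fun u : Vec d => ‖u‖ ^ k) ρ) (k : ℕ) (v : Vec d) :
    ∫ u, ‖u‖ ^ k * inner ℝ u v ^ 2 ∂ρ = (∫ u, ‖u‖ ^ (k + 2) ∂ρ) / d * ‖v‖ ^ 2 := by
  have hd0 : (d : ℝ) ≠ 0 := by positivity
  -- The reflection in the hyperplane orthogonal to `v - w` exchanges the equally long vectors `v`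
  -- and `w`, so the integral depends only on `‖v‖`. Summing over the vectors `‖v‖ e_i` then
  -- determines it.
  have hsame : ∀ w : Vec d, ‖v‖ = ‖w‖ →
      ∫ u, ‖u‖ ^ k * inner ℝ u v ^ 2 ∂ρ = ∫ u, ‖u‖ ^ k * inner ℝ u w ^ 2 ∂ρ := by
    intro w hw
    rw [← integral_comp_isometry hρ ((ℝ ∙ (v - w))ᗮ.reflection) (fun u => ‖u‖ ^ k * inner ℝ u w ^ 2)]
    congr 1
    ext u
    have := LinearIsometryEquiv.inner_map_map (𝕜 := ℝ) ((ℝ ∙ (v - w))ᗮ.reflection) u v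
    rw [Submodule.reflection_sub hw] at this
    rw [this, LinearIsometryEquiv.norm_map]
  have hsum : ∫ u, ∑ i : Fin d, ‖u‖ ^ k * inner ℝ u (‖v‖ • stdVec i : Vec d) ^ 2 ∂ρ
      = ∫ u, ‖v‖ ^ 2 * ‖u‖ ^ (k + 2) ∂ρ := by
    congr 1
    ext u
    rw [← Finset.mul_sum, pow_add, EuclideanSpace.real_norm_sq_eq u]
    simp only [stdVec, inner_smul_right, EuclideanSpace.inner_single_right, conj_trivial, one_mul,
      mul_pow, ← Finset.mul_sum]
    ring
  rw [integral_finsetSum _ fun i _ => integrable_norm_pow_mul_inner_sq hint k _] at hsum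
  rw [Finset.sum_congr rfl fun i _ => (hsame (‖v‖ • stdVec i) (by simp [stdVec, norm_smul])).symm,
    integral_const_mul, Finset.sum_const, Finset.card_univ, Fintype.card_fin, nsmul_eq_mul] at hsum
  field_simp
  linarith

/-- For a rotation invariant measure, the component of `𝔼[h(u) u]` along `v` is controlled by
the oscillation of `h` under the reflection in the hyperplane orthogonal to `v`. -/
lemma abs_integral_mul_inner_le (hd : 1 ≤ d) (hρ : ∀ e : Vec d ≃ₗᵢ[ℝ] Vec d, ρ.map e = ρ)
    (hint : ∀ k : ℕ, Integrable (fun u : Vec d => ‖u‖ ^ k) ρ) {h : Vec d → ℝ}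
    (hc : Continuous h) {K : ℝ} (hh : ∀ u, |h u| ≤ K / 3 * ‖u‖ ^ 3)
    (hosc : ∀ u u', ‖u'‖ ≤ ‖u‖ → |h u - h u'| ≤ K * ‖u‖ ^ 2 * ‖u - u'‖) (v : Vec d) :
    |∫ u, h u * inner ℝ u v ∂ρ| ≤ K * ((∫ u, ‖u‖ ^ 4 ∂ρ) / d) * ‖v‖ := by
  rcases eq_or_ne v 0 with rfl | hv
  · simp
  have hv' : 0 < ‖v‖ := norm_pos_iff.2 hv
  set e := (ℝ ∙ v)ᗮ.reflection with he
  have heu : ∀ u, e u = u - (2 * (inner ℝ v u / ‖v‖ ^ 2)) • v := by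
    intro u
    rw [he, Submodule.reflection_orthogonal_apply, Submodule.reflection_singleton_apply]
    simp [mul_smul, two_smul]
  have hev : ∀ u, inner ℝ (e u) v = -inner ℝ u v := by
    intro u
    rw [heu, inner_sub_left, inner_smul_left, real_inner_self_eq_norm_sq, conj_trivial,
      real_inner_comm v u]
    field_simp
    ring
  have hbase : ∀ g : Vec d → ℝ, Continuous g → (∀ u, |g u| ≤ K / 3 * ‖u‖ ^ 3) →
      Integrable (fun u => g u * inner ℝ u v) ρ := by
    intro g hg hb
    refine ((hint 4).const_mul (K / 3 * ‖v‖)).mono' (by fun_prop) (.of_forall fun u => ?_)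
    rw [norm_mul]
    calc _ ≤ (K / 3 * ‖u‖ ^ 3) * (‖u‖ * ‖v‖) :=
          mul_le_mul (hb u) (norm_inner_le_norm u v) (norm_nonneg _) ((abs_nonneg _).trans (hb u))
      _ = _ := by ring
  have h1 := hbase h hc hh
  have h2 := hbase (fun u => h (e u)) (hc.comp e.continuous) (fun u => by simpa using hh (e u))
  -- The reflection changes the sign of `⟨u, v⟩`, so only the odd part of `h` contributes.
  have hswap : ∫ u, h u * inner ℝ u v ∂ρ = -∫ u, h (e u) * inner ℝ u v ∂ρ := by
    rw [← integral_comp_isometry hρ e, ← integral_neg]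
    congr 1
    ext u
    rw [hev]
    ring
  have hhalf : ∫ u, h u * inner ℝ u v ∂ρ
      = 1 / 2 * ∫ u, (h u - h (e u)) * inner ℝ u v ∂ρ := by
    simp only [sub_mul]
    rw [integral_sub h1 h2]
    linarith
  -- A vector `u` moves by `2 |⟨u, v⟩| / ‖v‖` under the reflection. The oscillation bound therefore
  -- yields a second factor `⟨u, v⟩`, and isotropy of the integral of `‖u‖² ⟨u, v⟩²` provides the
  -- division by `d`.
  have hpt : ∀ u, ‖(h u - h (e u)) * inner ℝ u v‖
      ≤ 2 * K / ‖v‖ * (‖u‖ ^ 2 * inner ℝ u v ^ 2) := by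
    intro u
    have hd1 : ‖u - e u‖ = 2 * |inner ℝ u v| / ‖v‖ := by
      rw [heu, sub_sub_cancel, norm_smul, norm_mul, norm_div, real_inner_comm]
      simp only [Real.norm_eq_abs, Nat.abs_ofNat, norm_pow, abs_norm]
      field_simp
    have := hosc u (e u) (by simp)
    rw [hd1] at this
    rw [norm_mul]
    calc _ ≤ (K * ‖u‖ ^ 2 * (2 * |inner ℝ u v| / ‖v‖)) * |inner ℝ u v| :=
          mul_le_mul_of_nonneg_right this (abs_nonneg _)
      _ = _ := by rw [← sq_abs (inner ℝ u v)]; ring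
  have := norm_integral_le_of_norm_le
    ((integrable_norm_pow_mul_inner_sq hint 2 v).const_mul (2 * K / ‖v‖)) (.of_forall hpt)
  rw [integral_const_mul, integral_norm_pow_mul_inner_sq hd hρ hint, Real.norm_eq_abs] at this
  rw [hhalf, abs_mul, abs_of_pos (by norm_num : (0 : ℝ) < 1 / 2)]
  calc _ ≤ 1 / 2 * (2 * K / ‖v‖ * ((∫ u, ‖u‖ ^ 4 ∂ρ) / d * ‖v‖ ^ 2)) := by gcongr
    _ = _ := by field_simp

/-- The crude bound, with `1/3` in place of `1/d`; it is the sharper of the two in dimension one. -/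
lemma abs_integral_mul_inner_le' (hint : ∀ k : ℕ, Integrable (fun u : Vec d => ‖u‖ ^ k) ρ)
    {h : Vec d → ℝ} {K : ℝ} (hh : ∀ u, |h u| ≤ K / 3 * ‖u‖ ^ 3) (v : Vec d) :
    |∫ u, h u * inner ℝ u v ∂ρ| ≤ K / 3 * (∫ u, ‖u‖ ^ 4 ∂ρ) * ‖v‖ := by
  have := norm_integral_le_of_norm_le (f := fun u => h u * inner ℝ u v)
    ((hint 4).const_mul (K / 3 * ‖v‖)) (.of_forall fun u => by
      rw [norm_mul]
      calc _ ≤ (K / 3 * ‖u‖ ^ 3) * (‖u‖ * ‖v‖) :=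
            mul_le_mul (hh u) (norm_inner_le_norm u v) (norm_nonneg _) ((abs_nonneg _).trans (hh u))
        _ = _ := by ring)
  rw [integral_const_mul, Real.norm_eq_abs] at this
  linarith

/-- The contribution of one direction `u` to the finite-difference estimator of a function with
gradient `a`, where `h` is the error of the difference quotient. -/
noncomputable def dirTerm (a : Vec d) (h : Vec d → ℝ) (u : Vec d) : Vec d :=
  (inner ℝ a u + h u) • u

/-- The error is cubic in `‖u‖` and multiplies `u`, whence the eighth power. -/
lemma norm_dirTerm_sq_le (a : Vec d) {h : Vec d → ℝ} {K : ℝ}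
    (hh : ∀ u, |h u| ≤ K / 3 * ‖u‖ ^ 3) (u : Vec d) :
    ‖dirTerm a h u‖ ^ 2
      ≤ 2 * (‖u‖ ^ 2 * inner ℝ u a ^ 2) + 2 * (K / 3) ^ 2 * ‖u‖ ^ 8 := by
  rw [dirTerm, norm_smul, mul_pow, Real.norm_eq_abs, sq_abs, real_inner_comm]
  have h1 : h u ^ 2 ≤ (K / 3 * ‖u‖ ^ 3) ^ 2 := by
    rw [← sq_abs]
    have := hh u
    gcongr
  calc _ ≤ (2 * inner ℝ u a ^ 2 + 2 * (K / 3 * ‖u‖ ^ 3) ^ 2) * ‖u‖ ^ 2 := by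
        gcongr
        nlinarith [sq_nonneg (inner ℝ u a - h u)]
    _ = _ := by ring

lemma memLp_dirTerm (hint : ∀ k : ℕ, Integrable (fun u : Vec d => ‖u‖ ^ k) ρ) (a : Vec d)
    {h : Vec d → ℝ} (hc : Continuous h) {K : ℝ} (hh : ∀ u, |h u| ≤ K / 3 * ‖u‖ ^ 3) :
    MemLp (dirTerm a h) 2 ρ := by
  have hcont : Continuous (dirTerm a h) := by unfold dirTerm; fun_prop
  rw [memLp_two_iff_integrable_sq_norm hcont.aestronglyMeasurable]
  refine (((integrable_norm_pow_mul_inner_sq hint 2 a).const_mul 2).add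
    ((hint 8).const_mul (2 * (K / 3) ^ 2))).mono' (by fun_prop) (.of_forall fun u => ?_)
  rw [Real.norm_of_nonneg (by positivity)]
  exact norm_dirTerm_sq_le a hh u

/-- The descent estimate for estimators with independent directions from a rotation invariant
law. Here `D` bounds the bias of the estimator. -/
lemma integral_descent_le_of_iid [IsProbabilityMeasure ρ] (hd : 1 ≤ d) {N : ℕ} (hN : 1 ≤ N)
    (hρ : ∀ e : Vec d ≃ₗᵢ[ℝ] Vec d, ρ.map e = ρ)
    (hint : ∀ k : ℕ, Integrable (fun u : Vec d => ‖u‖ ^ k) ρ) {l : ℝ}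
    (hl : l * ∫ u, ‖u‖ ^ 2 ∂ρ = d) {h : Vec d → ℝ} (hc : Continuous h) {K : ℝ}
    (hh : ∀ u, |h u| ≤ K / 3 * ‖u‖ ^ 3) {D : ℝ} (hD : 0 ≤ D)
    (hbias : ∀ v, |l * ∫ u, h u * inner ℝ u v ∂ρ| ≤ D * ‖v‖) (a : Vec d) {c : ℝ} (hc0 : 0 ≤ c)
    (hc1 : c * (l ^ 2 / N * ((∫ u, ‖u‖ ^ 4 ∂ρ) / d) + (N - 1) / N) ≤ 1) :
    ∫ u : Fin N → Vec d, (-inner ℝ a ((l / N) • ∑ j, dirTerm a h (u j))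
        + c / 8 * ‖(l / N) • ∑ j, dirTerm a h (u j)‖ ^ 2) ∂(Measure.pi fun _ => ρ)
      ≤ -(1 / 4) * ‖a‖ ^ 2 + (1 / 2 * D ^ 2
        + c / 4 * (l ^ 2 / N * ((K / 3) ^ 2 * ∫ u, ‖u‖ ^ 8 ∂ρ) + (N - 1) / N * D ^ 2)) := by
  have hd0 : (d : ℝ) ≠ 0 := by positivity
  have hNpos : (0 : ℝ) < N := by positivity
  have hw := memLp_dirTerm hint a hc hh
  have hw1 : Integrable (dirTerm a h) ρ := hw.integrable (by norm_num)
  obtain ⟨hSint, hSval⟩ := integral_norm_sum_sq_pi hw N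
  have hj : ∀ j : Fin N, Integrable (fun u : Fin N → Vec d => dirTerm a h (u j))
      (Measure.pi fun _ => ρ) := fun j =>
    (measurePreserving_eval (fun _ : Fin N => ρ) j).integrable_comp_of_integrable hw1
  have hsum : ∫ u : Fin N → Vec d, ∑ j, dirTerm a h (u j) ∂(Measure.pi fun _ => ρ)
      = (N : ℝ) • ∫ u, dirTerm a h u ∂ρ := by
    rw [integral_finsetSum _ fun j _ => hj j]
    simp only [integral_comp_eval (μ := fun _ : Fin N => ρ) hw.1, Finset.sum_const,
      Finset.card_univ, Fintype.card_fin, Nat.cast_smul_eq_nsmul]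
  set E := l • ∫ u, dirTerm a h u ∂ρ with hE
  have hin1 : Integrable (fun u : Fin N → Vec d => (l / N) • ∑ j, dirTerm a h (u j))
      (Measure.pi fun _ => ρ) := (integrable_finsetSum _ fun j _ => hj j).smul (l / N : ℝ)
  have hin2 : Integrable (fun u : Fin N → Vec d =>
      -inner ℝ a ((l / N) • ∑ j, dirTerm a h (u j))) (Measure.pi fun _ => ρ) := (hin1.const_inner a).neg
  have hval : ∫ u : Fin N → Vec d, (-inner ℝ a ((l / N) • ∑ j, dirTerm a h (u j))
        + c / 8 * ‖(l / N) • ∑ j, dirTerm a h (u j)‖ ^ 2) ∂(Measure.pi fun _ => ρ)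
      = -inner ℝ a E + c / 8 * (l ^ 2 / N * ∫ u, ‖dirTerm a h u‖ ^ 2 ∂ρ
        + (N - 1) / N * ‖E‖ ^ 2) := by
    have hsq : ∀ u : Fin N → Vec d, ‖(l / N) • ∑ j, dirTerm a h (u j)‖ ^ 2
        = (l / N) ^ 2 * ‖∑ j, dirTerm a h (u j)‖ ^ 2 := by
      intro u
      rw [norm_smul, mul_pow, Real.norm_eq_abs, sq_abs]
    simp only [hsq]
    rw [integral_add hin2 ((hSint.const_mul _).const_mul _), integral_neg, integral_const_mul,
      integral_const_mul, hSval, integral_inner hin1,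
      integral_smul, hsum, smul_smul, div_mul_cancel₀ _ hNpos.ne', ← hE, hE, norm_smul, mul_pow,
      Real.norm_eq_abs, sq_abs]
    field_simp
  -- The normalization `l 𝔼‖u‖² = d` makes the linear part unbiased, by polarizing isotropy; what is
  -- left of `E - a` is the contribution of `h`.
  have hpol : ∀ v : Vec d, inner ℝ v E = inner ℝ v a + l * ∫ u, h u * inner ℝ u v ∂ρ := by
    intro v
    have h2 : ∀ v : Vec d, Integrable (fun u => inner ℝ u v ^ 2) ρ := fun v => by
      simpa using integrable_norm_pow_mul_inner_sq hint 0 v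
    have h2v : ∀ v : Vec d, ∫ u, inner ℝ u v ^ 2 ∂ρ = (∫ u, ‖u‖ ^ 2 ∂ρ) / d * ‖v‖ ^ 2 :=
      fun v => by simpa using integral_norm_pow_mul_inner_sq hd hρ hint 0 v
    have hcross : Integrable (fun u => inner ℝ a u * inner ℝ u v) ρ := by
      refine ((hint 2).const_mul (‖a‖ * ‖v‖)).mono' (by fun_prop) (.of_forall fun u => ?_)
      rw [norm_mul]
      calc _ ≤ (‖a‖ * ‖u‖) * (‖u‖ * ‖v‖) :=
            mul_le_mul (norm_inner_le_norm a u) (norm_inner_le_norm u v) (norm_nonneg _)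
              (by positivity)
        _ = _ := by ring
    have hcv : ∫ u, inner ℝ a u * inner ℝ u v ∂ρ = (∫ u, ‖u‖ ^ 2 ∂ρ) / d * inner ℝ v a := by
      have e1 : ∀ u : Vec d, inner ℝ a u * inner ℝ u v
          = 1 / 2 * (inner ℝ u (a + v) ^ 2 - inner ℝ u a ^ 2 - inner ℝ u v ^ 2) := by
        intro u
        rw [inner_add_right, real_inner_comm]
        ring
      have e3 : Integrable (fun u => inner ℝ u (a + v) ^ 2 - inner ℝ u a ^ 2) ρ :=
        (h2 _).sub (h2 _)
      simp only [e1]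
      rw [integral_const_mul, integral_sub e3 (h2 _), integral_sub (h2 _) (h2 _),
        h2v, h2v, h2v, norm_add_sq_real, real_inner_comm]
      ring
    have hhi : Integrable (fun u => h u * inner ℝ u v) ρ := by
      refine ((hint 4).const_mul (K / 3 * ‖v‖)).mono' (by fun_prop) (.of_forall fun u => ?_)
      rw [norm_mul]
      calc _ ≤ (K / 3 * ‖u‖ ^ 3) * (‖u‖ * ‖v‖) :=
            mul_le_mul (hh u) (norm_inner_le_norm u v) (norm_nonneg _)
              ((abs_nonneg _).trans (hh u))
        _ = _ := by ring
    have e2 : ∀ u, inner ℝ v (dirTerm a h u) = inner ℝ a u * inner ℝ u v + h u * inner ℝ u v := by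
      intro u
      rw [dirTerm, inner_smul_right, real_inner_comm u v]
      ring
    rw [hE, inner_smul_right, ← integral_inner hw1]
    simp only [e2]
    rw [integral_add hcross hhi, hcv, mul_add, ← mul_assoc, ← mul_div_assoc, hl, div_self hd0,
      one_mul]
  have hEa : ‖E - a‖ ≤ D := by
    rcases eq_or_ne (E - a) 0 with h0 | h0
    · rwa [h0, norm_zero]
    · have hpos := norm_pos_iff.2 h0
      have h1 := hbias (E - a)
      have h2 : l * ∫ u, h u * inner ℝ u (E - a) ∂ρ = ‖E - a‖ ^ 2 := by
        rw [← real_inner_self_eq_norm_sq, inner_sub_right, hpol]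
        ring
      rw [h2, abs_of_nonneg (by positivity), sq] at h1
      exact le_of_mul_le_mul_right h1 hpos
  have hinnerE : -inner ℝ a E ≤ -(1 / 2) * ‖a‖ ^ 2 + 1 / 2 * D ^ 2 := by
    have h1 : inner ℝ a E = ‖a‖ ^ 2 + inner ℝ a (E - a) := by
      rw [inner_sub_right, real_inner_self_eq_norm_sq]; ring
    have h2 := abs_le.1 (abs_real_inner_le_norm a (E - a))
    have h3 : ‖a‖ * ‖E - a‖ ≤ ‖a‖ * D := by gcongr
    nlinarith [sq_nonneg (‖a‖ - D)]
  have hnormE : ‖E‖ ^ 2 ≤ 2 * ‖a‖ ^ 2 + 2 * D ^ 2 := by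
    have h1 : ‖E‖ ≤ ‖a‖ + D := by
      linarith [norm_le_norm_add_norm_sub' E a]
    calc ‖E‖ ^ 2 ≤ (‖a‖ + D) ^ 2 := by gcongr
      _ ≤ _ := by nlinarith [sq_nonneg (‖a‖ - D)]
  have hsecond : ∫ u, ‖dirTerm a h u‖ ^ 2 ∂ρ
      ≤ 2 * ((∫ u, ‖u‖ ^ 4 ∂ρ) / d * ‖a‖ ^ 2) + 2 * (K / 3) ^ 2 * ∫ u, ‖u‖ ^ 8 ∂ρ := by
    have hi := (integrable_norm_pow_mul_inner_sq hint 2 a).const_mul 2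
    have hi' := (hint 8).const_mul (2 * (K / 3) ^ 2)
    have := integral_mono hw.integrable_norm_pow' (hi.add hi')
      (fun u => norm_dirTerm_sq_le a hh u)
    simp only [Pi.add_apply] at this
    rw [integral_add hi hi', integral_const_mul, integral_const_mul,
      integral_norm_pow_mul_inner_sq hd hρ hint] at this
    exact this
  rw [hval]
  have hN1 : (0 : ℝ) ≤ (N - 1) / N := by
    have : (1 : ℝ) ≤ N := by exact_mod_cast hN
    exact div_nonneg (by linarith) hNpos.le
  have hlN : (0 : ℝ) ≤ l ^ 2 / N := by positivity
  have hA := mul_le_mul_of_nonneg_left hsecond hlN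
  have hB := mul_le_mul_of_nonneg_left hnormE hN1
  have hAB := mul_le_mul_of_nonneg_left (add_le_add hA hB) (by positivity : 0 ≤ c / 8)
  -- The inner product leaves `-‖a‖²/2`; the hypothesis on `c` limits the `‖a‖²` part of the second
  -- moment to `‖a‖²/4`.
  have hC := mul_le_mul_of_nonneg_right hc1 (by positivity : 0 ≤ 1 / 4 * ‖a‖ ^ 2)
  nlinarith [hinnerE, hAB, hC]

end Invariant

/-! ### Descent for isotropic orthonormal directions. -/

section Orthonormal

variable {d : ℕ}

/-- The descent estimate for estimators with isotropic orthonormal directions. -/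
lemma integral_descent_le_of_orthonormal (hd : 1 ≤ d) {N : ℕ} (hN : 1 ≤ N)
    {τ : Measure (Fin N → Vec d)} [IsProbabilityMeasure τ] (hτ : ∀ᵐ u ∂τ, Orthonormal ℝ u)
    (hiso : ∀ v : Vec d, ∫ u, ∑ j, (inner ℝ (u j) v) ^ 2 ∂τ = (N : ℝ) / d * ‖v‖ ^ 2)
    {h : Vec d → ℝ} (hc : Continuous h) {K : ℝ} (hh : ∀ u, |h u| ≤ K / 3 * ‖u‖ ^ 3) (a : Vec d) :
    ∫ u : Fin N → Vec d, (-inner ℝ a (((d : ℝ) / N) • ∑ j, dirTerm a h (u j))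
        + (N / d) / 8 * ‖((d : ℝ) / N) • ∑ j, dirTerm a h (u j)‖ ^ 2) ∂τ
      ≤ -(1 / 4) * ‖a‖ ^ 2 + 3 / 4 * (d * (K / 3) ^ 2) := by
  have hd0 : (0 : ℝ) < d := by positivity
  have hN0 : (0 : ℝ) < N := by positivity
  have hA : Integrable (fun u : Fin N → Vec d => ∑ j, (inner ℝ (u j) a) ^ 2) τ := by
    refine Integrable.of_bound (Continuous.aestronglyMeasurable (by fun_prop))
      (∑ j : Fin N, ‖a‖ ^ 2) ?_
    filter_upwards [hτ] with u hu
    rw [Real.norm_of_nonneg (by positivity)]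
    refine Finset.sum_le_sum fun j _ => ?_
    have := abs_real_inner_le_norm (u j) a
    rw [hu.1 j, one_mul] at this
    rw [← sq_abs]
    gcongr
  -- Orthonormality removes the cross terms, and the factor `N/d` cancels one of the two factors
  -- `d/N` in the square.
  have hsplit : ∀ u : Fin N → Vec d, Orthonormal ℝ u →
      -inner ℝ a (((d : ℝ) / N) • ∑ j, dirTerm a h (u j))
        + (N / d) / 8 * ‖((d : ℝ) / N) • ∑ j, dirTerm a h (u j)‖ ^ 2
      = ((d : ℝ) / N) * ∑ j, (-(inner ℝ a (u j) + h (u j)) * inner ℝ a (u j)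
          + 1 / 8 * (inner ℝ a (u j) + h (u j)) ^ 2) := by
    intro u hu
    have h1 : ‖∑ j, dirTerm a h (u j)‖ ^ 2 = ∑ j, (inner ℝ a (u j) + h (u j)) ^ 2 := by
      rw [← real_inner_self_eq_norm_sq]
      simp only [dirTerm]
      rw [hu.inner_sum]
      simp [sq]
    rw [norm_smul, mul_pow, h1, inner_smul_right, inner_sum, Real.norm_eq_abs, sq_abs,
      Finset.sum_add_distrib, ← Finset.mul_sum]
    simp only [dirTerm, inner_smul_right, neg_mul, Finset.sum_neg_distrib]
    field_simp
  have hpt : ∀ u : Fin N → Vec d, Orthonormal ℝ u →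
      -inner ℝ a (((d : ℝ) / N) • ∑ j, dirTerm a h (u j))
        + (N / d) / 8 * ‖((d : ℝ) / N) • ∑ j, dirTerm a h (u j)‖ ^ 2
      ≤ -(1 / 4) * ((d : ℝ) / N) * ∑ j, (inner ℝ (u j) a) ^ 2 + 3 / 4 * (d * (K / 3) ^ 2) := by
    intro u hu
    rw [hsplit u hu]
    -- With `p = ⟨u_j, a⟩`, the identity `2 (p + h) p = (p + h)² + p² - h²` leaves a nonpositive
    -- multiple of `(p + h)²`. Summed with weight `d/N`, the constant `3/4 (K/3)²` becomes `d K² /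
    -- 12`, which is `Ω₂` for `K = M ν² / 2`.
    have hterm : ∀ j ∈ Finset.univ, -(inner ℝ a (u j) + h (u j)) * inner ℝ a (u j)
          + 1 / 8 * (inner ℝ a (u j) + h (u j)) ^ 2
        ≤ -(1 / 4) * inner ℝ (u j) a ^ 2 + 3 / 4 * (K / 3) ^ 2 := by
      intro j _
      have h1 := hh (u j)
      rw [hu.1 j, one_pow, mul_one] at h1
      have h2 : h (u j) ^ 2 ≤ (K / 3) ^ 2 := by
        rw [← sq_abs]
        gcongr
      rw [real_inner_comm]
      nlinarith [sq_nonneg (inner ℝ (u j) a + h (u j))]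
    calc _ ≤ ((d : ℝ) / N) * ∑ j : Fin N, (-(1 / 4) * inner ℝ (u j) a ^ 2 + 3 / 4 * (K / 3) ^ 2) := by
          exact mul_le_mul_of_nonneg_left (Finset.sum_le_sum hterm) (by positivity)
      _ = _ := by
          rw [Finset.sum_add_distrib, ← Finset.mul_sum]
          simp
          field_simp
  have hbound : Integrable (fun u : Fin N → Vec d =>
      -inner ℝ a (((d : ℝ) / N) • ∑ j, dirTerm a h (u j))
        + (N / d) / 8 * ‖((d : ℝ) / N) • ∑ j, dirTerm a h (u j)‖ ^ 2) τ := by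
    have hcont : Continuous (dirTerm a h) := by unfold dirTerm; fun_prop
    set b : ℝ := ((d : ℝ) / N) * ∑ j : Fin N, (‖a‖ + K / 3) with hb
    have hnorm : ∀ᵐ u ∂τ, ‖((d : ℝ) / N) • ∑ j, dirTerm a h (u j)‖ ≤ b := by
      filter_upwards [hτ] with u hu
      rw [norm_smul, Real.norm_of_nonneg (by positivity)]
      refine mul_le_mul_of_nonneg_left ((norm_sum_le _ _).trans (Finset.sum_le_sum fun j _ => ?_))
        (by positivity)
      have h1 := hh (u j)
      have h2 := abs_real_inner_le_norm a (u j)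
      rw [hu.1 j, one_pow, mul_one] at h1
      rw [hu.1 j, mul_one] at h2
      rw [dirTerm, norm_smul, hu.1 j, mul_one, Real.norm_eq_abs]
      exact (abs_add_le _ _).trans (add_le_add h2 h1)
    refine Integrable.of_bound (by fun_prop) (‖a‖ * b + (N / d) / 8 * b ^ 2) ?_
    filter_upwards [hnorm] with u hu
    refine (norm_add_le _ _).trans (add_le_add ?_ ?_)
    · rw [norm_neg]
      exact (norm_inner_le_norm _ _).trans (by gcongr)
    · rw [Real.norm_of_nonneg (by positivity)]
      gcongr
  have := integral_mono_ae hbound ((hA.const_mul (-(1 / 4) * ((d : ℝ) / N))).add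
    (integrable_const (3 / 4 * (d * (K / 3) ^ 2)))) (by
      filter_upwards [hτ] with u hu using hpt u hu)
  refine this.trans (le_of_eq ?_)
  simp only [Pi.add_apply]
  rw [integral_add (hA.const_mul _) (integrable_const _), integral_const_mul, hiso]
  simp
  field_simp

end Orthonormal

end CFD

/-! ### The direction laws of the five schemes. -/

namespace CFD

/-- The ratio `ᾱ / Ω₁`. -/
noncomputable def stepFactor (m : Scheme) (d N : ℕ) : ℝ :=
  match m with
  | .cFD => 1
  | .cGS => N / (N + 4.5 * d)
  | .cSS => N / (N + 4.5 * d)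
  | .cRC => N / d
  | .cRS => N / d

lemma alphaBar_eq (m : Scheme) (d N : ℕ) (θ L : ℝ) :
    alphaBar m d N θ L = stepFactor m d N * Omega₁ θ L := by
  cases m <;> simp [alphaBar, stepFactor]

lemma stepFactor_pos (m : Scheme) {d N : ℕ} (hd : 1 ≤ d) (hN : 1 ≤ N) : 0 < stepFactor m d N := by
  cases m <;> simp only [stepFactor] <;> positivity

lemma alphaBar_pos (m : Scheme) {d N : ℕ} (hd : 1 ≤ d) (hN : 1 ≤ N) (θ : ℝ) {L : ℝ} (hL : 0 < L) :
    0 < alphaBar m d N θ L := by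
  rw [alphaBar_eq]
  have : 0 < Omega₁ θ L := by unfold Omega₁; positivity
  exact mul_pos (stepFactor_pos m hd hN) this

lemma chi_pos (m : Scheme) {d N : ℕ} (hd : 1 ≤ d) (hN : 1 ≤ N) {M ν : ℝ} (hM : 0 < M)
    (hν : 0 < ν) : 0 < chi m d N M ν := by
  have : 0 < Omega₂ d M ν := by unfold Omega₂; positivity
  cases m <;> simp only [chi] <;> positivity

variable {d N : ℕ} {τ : Measure (Fin N → Vec d)}

lemma inner_stdVec (j : Fin d) (v : Vec d) : inner ℝ (stdVec j) v = v j := by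
  simp [stdVec, EuclideanSpace.inner_single_left]

lemma orthonormal_stdVec {e : Fin N → Fin d} (he : Function.Injective e) :
    Orthonormal ℝ (fun j => (stdVec (e j) : Vec d)) := by
  have := (EuclideanSpace.basisFun (Fin d) ℝ).orthonormal.comp e he
  simpa [Function.comp_def, stdVec] using this

lemma IsDirectionLaw.cRS_of_cFD (h : IsDirectionLaw .cFD τ) : IsDirectionLaw .cRS τ := by
  obtain ⟨rfl, rfl⟩ := h
  simp only [Fin.cast_eq_self]
  refine ⟨?_, fun v => ?_⟩
  · rw [ae_dirac_eq]
    exact orthonormal_stdVec Function.injective_id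
  · rw [integral_dirac]
    simp only [inner_stdVec, ← EuclideanSpace.real_norm_sq_eq]
    rcases Nat.eq_zero_or_pos N with rfl | hN
    · simp [Subsingleton.elim v 0]
    · have : (N : ℝ) ≠ 0 := by positivity
      field_simp

/-- Cyclic shifts of `Fin d` permute the embeddings, so each entry of a uniformly random embedding
is uniform on `Fin d`. -/
lemma sum_embedding_apply (hd : 1 ≤ d) (g : Fin d → ℝ) (j : Fin N) :
    (d : ℝ) * ∑ e : Fin N ↪ Fin d, g (e j) = Fintype.card (Fin N ↪ Fin d) * ∑ i, g i := by
  have : NeZero d := ⟨by omega⟩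
  have hshift : ∀ s : Fin d, ∑ e : Fin N ↪ Fin d, g (e j) = ∑ e : Fin N ↪ Fin d, g (e j + s) := by
    intro s
    exact (Fintype.sum_equiv (Equiv.embeddingCongr (Equiv.refl (Fin N)) (Equiv.addRight s)) _ _
      (fun e => by simp)).symm
  calc (d : ℝ) * ∑ e : Fin N ↪ Fin d, g (e j)
      = ∑ s : Fin d, ∑ e : Fin N ↪ Fin d, g (e j + s) := by
        rw [← Finset.sum_congr rfl fun s _ => hshift s]
        simp
    _ = ∑ e : Fin N ↪ Fin d, ∑ i, g i := by
        rw [Finset.sum_comm]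
        exact Finset.sum_congr rfl fun e _ => Equiv.sum_comp (Equiv.addLeft (e j)) g
    _ = _ := by simp

lemma IsDirectionLaw.cRS_of_cRC [IsProbabilityMeasure τ] (hd : 1 ≤ d)
    (h : IsDirectionLaw .cRC τ) : IsDirectionLaw .cRS τ := by
  have hτ : τ = (Fintype.card (Fin N ↪ Fin d) : ENNReal)⁻¹ •
      ∑ e : Fin N ↪ Fin d, Measure.dirac (fun j => (stdVec (e j) : Vec d)) := h
  -- Without embeddings the defining sum is empty and `τ` would vanish, so a probability law forces
  -- `N ≤ d`.
  have hcard : (Fintype.card (Fin N ↪ Fin d) : ℝ) ≠ 0 := by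
    intro h0
    have : IsEmpty (Fin N ↪ Fin d) := Fintype.card_eq_zero_iff.1 (by exact_mod_cast h0)
    have h1 : τ = 0 := by rw [hτ]; simp
    exact IsProbabilityMeasure.ne_zero τ h1
  refine ⟨?_, fun v => ?_⟩
  · rw [hτ]
    refine Measure.ae_smul_measure ?_ _
    rw [← Measure.sum_fintype, Measure.ae_sum_iff]
    intro e
    rw [ae_dirac_eq]
    exact orthonormal_stdVec e.injective
  · rw [hτ, integral_smul_measure, integral_finsetSum_measure fun e _ => integrable_dirac (by simp)]
    simp only [integral_dirac, inner_stdVec]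
    rw [Finset.sum_comm]
    have hd0 : (d : ℝ) ≠ 0 := by positivity
    have hj : ∀ j : Fin N, ∑ e : Fin N ↪ Fin d, v (e j) ^ 2
        = Fintype.card (Fin N ↪ Fin d) / d * ‖v‖ ^ 2 := by
      intro j
      rw [EuclideanSpace.real_norm_sq_eq, div_mul_eq_mul_div, eq_div_iff hd0, mul_comm,
        sum_embedding_apply hd (fun i => v i ^ 2) j]
    simp only [hj, Finset.sum_const, Finset.card_univ, Fintype.card_fin, nsmul_eq_mul,
      ENNReal.toReal_inv, ENNReal.toReal_natCast, smul_eq_mul]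
    field_simp

lemma integrable_norm_pow_sphereUniform (hd : 1 ≤ d) (k : ℕ) :
    Integrable (fun u : Vec d => ‖u‖ ^ k) (sphereUniform d) := by
  have := isProbabilityMeasure_sphereUniform hd
  refine (integrable_const (1 : ℝ)).congr ?_
  filter_upwards [ae_norm_eq_one_sphereUniform] with u hu
  rw [hu, one_pow]

lemma integral_norm_pow_sphereUniform (hd : 1 ≤ d) (k : ℕ) :
    ∫ u : Vec d, ‖u‖ ^ k ∂(sphereUniform d) = 1 := by
  have := isProbabilityMeasure_sphereUniform hd
  rw [integral_congr_ae (g := fun _ => (1 : ℝ))]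
  · simp
  · filter_upwards [ae_norm_eq_one_sphereUniform] with u hu
    rw [hu, one_pow]

lemma IsDirectionLaw.integrable_norm_pow [IsProbabilityMeasure τ] {m : Scheme} (hd : 1 ≤ d)
    (h : IsDirectionLaw m τ) (j : Fin N) (k : ℕ) :
    Integrable (fun u : Fin N → Vec d => ‖u j‖ ^ k) τ := by
  have hRS : IsDirectionLaw .cRS τ → Integrable (fun u : Fin N → Vec d => ‖u j‖ ^ k) τ := by
    intro h
    refine (integrable_const (1 : ℝ)).congr ?_
    filter_upwards [h.1] with u hu
    rw [hu.1 j, one_pow]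
  cases m with
  | cFD => exact hRS h.cRS_of_cFD
  | cRC => exact hRS (h.cRS_of_cRC hd)
  | cRS => exact hRS h
  | cGS =>
    have h : τ = Measure.pi (fun _ => stdGaussian (Vec d)) := h
    rw [h]
    exact (measurePreserving_eval (fun _ : Fin N => stdGaussian (Vec d)) j).integrable_comp_of_integrable
      (integrable_norm_pow_stdGaussian d k)
  | cSS =>
    have := isProbabilityMeasure_sphereUniform hd
    have h : τ = Measure.pi (fun _ => sphereUniform d) := h
    rw [h]
    exact (measurePreserving_eval (fun _ : Fin N => sphereUniform d) j).integrable_comp_of_integrable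
      (integrable_norm_pow_sphereUniform hd k)

/-- The expected decrease for a direction `T` drawn from the law of a scheme, for a function with
gradient `a` and difference-quotient error `h`. -/
lemma IsDirectionLaw.integral_descent_le [IsProbabilityMeasure τ] {m : Scheme} (hd : 1 ≤ d)
    (hN : 1 ≤ N) (hlaw : IsDirectionLaw m τ) {M ν : ℝ} (hM : 0 ≤ M) {h : Vec d → ℝ}
    (hc : Continuous h) (hh : ∀ u, |h u| ≤ M * ν ^ 2 / 6 * ‖u‖ ^ 3)
    (hosc : ∀ u u', ‖u'‖ ≤ ‖u‖ → |h u - h u'| ≤ M * ν ^ 2 / 2 * ‖u‖ ^ 2 * ‖u - u'‖) (a : Vec d) :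
    ∫ u : Fin N → Vec d, (-inner ℝ a (scaling m d N • ∑ j, dirTerm a h (u j))
        + stepFactor m d N / 8 * ‖scaling m d N • ∑ j, dirTerm a h (u j)‖ ^ 2) ∂τ
      ≤ -(1 / 4) * ‖a‖ ^ 2 + chi m d N M ν := by
  set K : ℝ := M * ν ^ 2 / 2 with hK
  have hK0 : 0 ≤ K := by positivity
  have hh' : ∀ u, |h u| ≤ K / 3 * ‖u‖ ^ 3 := fun u => (hh u).trans (le_of_eq (by rw [hK]; ring))
  have hd1 : (1 : ℝ) ≤ d := by exact_mod_cast hd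
  have hd0 : (0 : ℝ) < d := by positivity
  have hN1 : (1 : ℝ) ≤ N := by exact_mod_cast hN
  have hN0 : (0 : ℝ) < N := by positivity
  have hΩ : Omega₂ d M ν = d * (K ^ 2 / 12) := by rw [Omega₂, hK]; ring
  have hRS : IsDirectionLaw .cRS τ → ∫ u : Fin N → Vec d,
      (-inner ℝ a (((d : ℝ) / N) • ∑ j, dirTerm a h (u j))
        + (N / d) / 8 * ‖((d : ℝ) / N) • ∑ j, dirTerm a h (u j)‖ ^ 2) ∂τ
      ≤ -(1 / 4) * ‖a‖ ^ 2 + Omega₂ d M ν := by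
    intro h
    refine (integral_descent_le_of_orthonormal hd hN h.1 h.2 hc hh' a).trans (le_of_eq ?_)
    rw [hΩ]
    ring
  cases m with
  | cFD =>
    obtain ⟨hNd, -⟩ := id hlaw
    have := hRS hlaw.cRS_of_cFD
    subst hNd
    simpa [div_self hN0.ne', scaling, stepFactor, chi] using this
  | cRC => exact hRS (hlaw.cRS_of_cRC hd)
  | cRS => exact hRS hlaw
  | cGS =>
    have h : τ = Measure.pi (fun _ => stdGaussian (Vec d)) := hlaw
    subst h
    have m2 : ∫ u : Vec d, ‖u‖ ^ 2 ∂(stdGaussian (Vec d)) = d := by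
      simpa [Finset.prod_range_succ] using integral_norm_pow_stdGaussian d (k := 1) (by norm_num)
    have m4 : ∫ u : Vec d, ‖u‖ ^ 4 ∂(stdGaussian (Vec d)) = d * (d + 2) := by
      simpa [Finset.prod_range_succ] using integral_norm_pow_stdGaussian d (k := 2) (by norm_num)
    have m8 : ∫ u : Vec d, ‖u‖ ^ 8 ∂(stdGaussian (Vec d)) = d * (d + 2) * (d + 4) * (d + 6) := by
      have := integral_norm_pow_stdGaussian d (k := 4) (by norm_num)
      norm_num [Finset.prod_range_succ] at this
      exact this
    have hint := integrable_norm_pow_stdGaussian d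
    -- The value `2 K d` is the one built into `χ`. Reflection gives `K (d + 2)`, which suffices for
    -- `d ≥ 2`; for `d = 1` the crude bound gives `K`.
    have hbias : ∀ v, |(1 : ℝ) * ∫ u, h u * inner ℝ u v ∂(stdGaussian (Vec d))|
        ≤ (2 * K * d) * ‖v‖ := by
      intro v
      rw [one_mul]
      rcases eq_or_lt_of_le hd with h1 | h2
      · refine (abs_integral_mul_inner_le' hint hh' v).trans ?_
        have : (d : ℝ) = 1 := by exact_mod_cast h1.symm
        rw [m4, this]
        gcongr ?_ * ‖v‖
        linarith
      · refine (abs_integral_mul_inner_le hd (fun e => stdGaussian_map e) hint hc hh' hosc v).trans ?_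
        have : (2 : ℝ) ≤ d := by exact_mod_cast h2
        rw [m4, mul_div_cancel_left₀ _ hd0.ne']
        gcongr ?_ * ‖v‖
        nlinarith
    have key := integral_descent_le_of_iid hd hN (fun e => stdGaussian_map e) hint
      (l := 1) (by rw [one_mul, m2]) hc hh' (by positivity) hbias a
      -- With fourth moment `d (d + 2)` the condition on `c` reads `N + d + 1 ≤ N + 4.5 d`.
      (c := (N : ℝ) / (N + 4.5 * d)) (by positivity) (by
        rw [m4]
        field_simp
        linarith)
    refine key.trans (add_le_add le_rfl ?_)
    rw [m8]
    simp only [chi, hΩ]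
    rw [← sub_nonneg]
    -- The terms `72 N d + 216 d²` of `χ` match the bias terms in `D²` except for the `-1` in `N -
    -- 1`, which leaves `d²`; the eighth moment enters with `1/36` against `1/24` in `χ`, which
    -- leaves `1/72`.
    have : (72 * N * d + 216 * (d : ℝ) ^ 2 + (d + 2) * (d + 4) * (d + 6)) / (2 * (N + 4.5 * d))
        * (d * (K ^ 2 / 12)) - (1 / 2 * (2 * K * d) ^ 2 + N / (N + 4.5 * d) / 4
          * (1 ^ 2 / N * ((K / 3) ^ 2 * (d * (d + 2) * (d + 4) * (d + 6)))
            + (N - 1) / N * (2 * K * d) ^ 2))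
        = (d * (d + 2) * (d + 4) * (d + 6) / 72 + d ^ 2) * K ^ 2 / (N + 4.5 * d) := by
      field_simp
      ring
    rw [this]
    positivity
  | cSS =>
    have := isProbabilityMeasure_sphereUniform hd
    have h : τ = Measure.pi (fun _ => sphereUniform d) := hlaw
    subst h
    have mk := fun k => integral_norm_pow_sphereUniform (d := d) hd k
    have hint := fun k => integrable_norm_pow_sphereUniform (d := d) hd k
    -- Reflection gives the bias bound `K`; it is relaxed to `2 K`, the value corresponding to `72 N
    -- + 216 d` in `χ`.
    have hbias : ∀ v, |(d : ℝ) * ∫ u, h u * inner ℝ u v ∂(sphereUniform d)| ≤ (2 * K) * ‖v‖ := by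
      intro v
      rw [abs_mul, abs_of_pos hd0]
      have := abs_integral_mul_inner_le hd map_sphereUniform hint hc hh' hosc v
      rw [mk] at this
      calc _ ≤ d * (K * (1 / d) * ‖v‖) := by gcongr
        _ = K * ‖v‖ := by field_simp
        _ ≤ _ := by gcongr; linarith
    have key := integral_descent_le_of_iid hd hN map_sphereUniform hint
      (l := d) (by rw [mk, mul_one]) hc hh' (by positivity) hbias a
      (c := (N : ℝ) / (N + 4.5 * d)) (by positivity) (by
        rw [mk]
        field_simp
        linarith)
    refine key.trans (add_le_add le_rfl ?_)
    rw [mk]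
    simp only [chi, hΩ]
    rw [← sub_nonneg]
    have : (72 * N + 216 * (d : ℝ) + d ^ 2) / (2 * d * (N + 4.5 * d))
        * (d * (K ^ 2 / 12)) - (1 / 2 * (2 * K) ^ 2 + N / (N + 4.5 * d) / 4
          * ((d : ℝ) ^ 2 / N * ((K / 3) ^ 2 * 1) + (N - 1) / N * (2 * K) ^ 2))
        = (d ^ 2 / 72 + 1) * K ^ 2 / (N + 4.5 * d) := by
      field_simp
      ring
    rw [this]
    positivity

end CFD

namespace CFD

/-! ### Conditional laws of the sample and of the directions. -/

section Kernel

variable {Ξ : Type*} [MeasurableSpace Ξ]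

/-- The law of a sample of `n` independent draws from `P`, as a kernel in `n`. -/
noncomputable def sampleKernel (P : Measure Ξ) : Kernel ℕ (Sample Ξ) :=
  Kernel.ofFunOfCountable fun n => (Measure.pi fun _ : Fin n => P).map fun z => ⟨n, z⟩

lemma measurable_sigma_mk (n : ℕ) : Measurable fun z : Fin n → Ξ => (⟨n, z⟩ : Sample Ξ) :=
  measurable_iff_le_map.2 (iInf_le _ n)

/-- The σ-algebra on `Sample Ξ` is the largest one for which all inclusions of fixed-size samples
are measurable. -/
lemma measurable_sample_iff {α : Type*} [MeasurableSpace α] {g : Sample Ξ → α} :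
    Measurable g ↔ ∀ n, Measurable fun z : Fin n → Ξ => g ⟨n, z⟩ := by
  refine ⟨fun h n => h.comp (measurable_sigma_mk n), fun h A hA => ?_⟩
  exact MeasurableSpace.measurableSet_iInf.2 fun n => h n hA

lemma sampleKernel_apply (P : Measure Ξ) (n : ℕ) :
    sampleKernel P n = (Measure.pi fun _ : Fin n => P).map fun z => ⟨n, z⟩ := rfl

instance (P : Measure Ξ) [IsProbabilityMeasure P] : IsMarkovKernel (sampleKernel P) :=
  ⟨fun n => by
    rw [sampleKernel_apply]
    exact Measure.isProbabilityMeasure_map (measurable_sigma_mk n).aemeasurable⟩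

variable {d : ℕ} {Ω : Type*} [mΩ : MeasurableSpace Ω] {N : ℕ → ℕ} {μ : Measure Ω}
  [IsProbabilityMeasure μ] {P : Measure Ξ} [IsProbabilityMeasure P] {m : Scheme}
  {T : (k : ℕ) → Ω → Fin (N k) → Vec d} {S : ℕ → Ω → Sample Ξ}

lemma Sampling.past_le (h : Sampling μ P m T S) (k : ℕ) : past T S k ≤ mΩ :=
  iSup_le fun j => sup_le (h.measurable_T j).comap_le (h.measurable_S j).comap_le

lemma Sampling.pastHalf_le (h : Sampling μ P m T S) (k : ℕ) : pastHalf T S k ≤ mΩ :=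
  sup_le (h.past_le k) (h.measurable_T k).comap_le

/-- The sample of iteration `k` avoids no set: its conditional distribution given the past and the
directions is the sample kernel at the sample size. -/
lemma Sampling.measure_inter_preimage (h : Sampling μ P m T S) (k : ℕ) {B : Set Ω}
    (hB : MeasurableSet[pastHalf T S k] B) {A : Set (Sample Ξ)} (hA : MeasurableSet A) :
    μ (B ∩ S k ⁻¹' A) = ∫⁻ ω in B, sampleKernel P (S k ω).1 A ∂μ := by
  have hsize : Measurable fun ω => (S k ω).1 := (h.size_past k).mono (h.past_le k) le_rfl
  have hB' := h.pastHalf_le k B hB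
  have hSA : MeasurableSet (S k ⁻¹' A) := h.measurable_S k hA
  -- Both sides are split along the countably many values of the sample size, since `iid_S` speaks
  -- of one size at a time.
  have hL : μ (B ∩ S k ⁻¹' A) = ∑' n, μ (B ∩ S k ⁻¹' A ∩ (fun ω => (S k ω).1) ⁻¹' {n}) := by
    have h1 : (μ.restrict (B ∩ S k ⁻¹' A)).map (fun ω => (S k ω).1) Set.univ
        = μ (B ∩ S k ⁻¹' A) := by
      rw [Measure.map_apply hsize .univ]
      simp
    rw [← h1, ← lintegral_one, lintegral_countable']
    refine tsum_congr fun n => ?_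
    rw [one_mul, Measure.map_apply hsize (measurableSet_singleton n),
      Measure.restrict_apply (hsize (measurableSet_singleton n)), Set.inter_comm]
  have hR : ∫⁻ ω in B, sampleKernel P (S k ω).1 A ∂μ
      = ∑' n, sampleKernel P n A * μ (B ∩ (fun ω => (S k ω).1) ⁻¹' {n}) := by
    rw [← lintegral_map (f := fun n => sampleKernel P n A) (measurable_of_countable _) hsize,
      lintegral_countable']
    refine tsum_congr fun n => ?_
    rw [Measure.map_apply hsize (measurableSet_singleton n),
      Measure.restrict_apply (hsize (measurableSet_singleton n)), Set.inter_comm]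
  rw [hL, hR]
  refine tsum_congr fun n => ?_
  rw [sampleKernel_apply, Measure.map_apply (measurable_sigma_mk n) hA, mul_comm]
  have := h.iid_S k n B hB _ (measurable_sigma_mk n hA)
  refine Eq.trans (congrArg μ ?_) this
  ext ω
  simp only [Set.mem_inter_iff, Set.mem_preimage, Set.mem_singleton_iff, Set.mem_ofPred_eq,
    and_assoc, and_congr_right_iff]
  intro _
  rcases hS : S k ω with ⟨n', z⟩
  constructor
  · rintro ⟨h1, h2⟩
    obtain rfl : n' = n := h2
    exact ⟨z, h1, rfl⟩
  · rintro ⟨z', h1, h2⟩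
    rw [h2]
    exact ⟨h1, rfl⟩

variable {α : Type*} [MeasurableSpace α] {Y : Ω → α} {size : α → ℕ}

/-- The joint law of the past data `Y` and the sample. -/
lemma Sampling.map_prodMk (h : Sampling μ P m T S) (k : ℕ) {B : Set Ω}
    (hB : MeasurableSet[pastHalf T S k] B) (hY : Measurable[pastHalf T S k] Y)
    (hs : Measurable size) (hYs : ∀ ω, size (Y ω) = (S k ω).1) :
    (μ.restrict B).map (fun ω => (Y ω, S k ω))
      = ((μ.restrict B).map Y) ⊗ₘ ((sampleKernel P).comap size hs) := by
  have hYm : Measurable Y := hY.mono (h.pastHalf_le k) le_rfl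
  have := Measure.isFiniteMeasure_map (μ.restrict B) (fun ω => (Y ω, S k ω))
  refine Measure.ext_prod fun {s t} hs' ht => ?_
  rw [Measure.compProd_apply_prod hs' ht,
    Measure.map_apply (hYm.prodMk (h.measurable_S k)) (hs'.prod ht),
    setLIntegral_map hs' (Kernel.measurable_coe _ ht) hYm, Measure.restrict_restrict (hYm hs'),
    Measure.restrict_apply ((hYm.prodMk (h.measurable_S k)) (hs'.prod ht))]
  simp only [Kernel.comap_apply, hYs]
  rw [← h.measure_inter_preimage k ((hY hs').inter hB) ht]
  congr 1
  ext ω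
  simp only [Set.mem_inter_iff, Set.mem_preimage, Set.mem_prod]
  tauto

/-- Tonelli for the composition with the kernel: for a nonnegative function, an integrable bound on
the conditional means is enough. -/
lemma Sampling.integrable_of_kernel (h : Sampling μ P m T S) (k : ℕ)
    (hY : Measurable[pastHalf T S k] Y) (hs : Measurable size)
    (hYs : ∀ ω, size (Y ω) = (S k ω).1) {Φ : α × Sample Ξ → ℝ} (hΦ : Measurable Φ)
    (hΦ0 : ∀ p, 0 ≤ Φ p) (hint : ∀ ω, Integrable (fun s => Φ (Y ω, s)) (sampleKernel P (S k ω).1))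
    {b : Ω → ℝ} (hb : Integrable b μ)
    (hle : ∀ ω, ∫ s, Φ (Y ω, s) ∂(sampleKernel P (S k ω).1) ≤ b ω) :
    Integrable (fun ω => Φ (Y ω, S k ω)) μ := by
  have hYm : Measurable Y := hY.mono (h.pastHalf_le k) le_rfl
  have hmap := h.map_prodMk k (B := Set.univ) MeasurableSet.univ hY hs hYs
  rw [Measure.restrict_univ] at hmap
  suffices Integrable Φ (μ.map (fun ω => (Y ω, S k ω))) from
    this.comp_measurable (hYm.prodMk (h.measurable_S k))
  rw [hmap, Measure.integrable_compProd_iff hΦ.aestronglyMeasurable]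
  have hSM : StronglyMeasurable fun y => ∫ s, ‖Φ (y, s)‖ ∂((sampleKernel P).comap size hs y) :=
    StronglyMeasurable.integral_kernel_prod_right' hΦ.norm.stronglyMeasurable
  constructor
  · rw [ae_map_iff hYm.aemeasurable]
    · refine .of_forall fun ω => ?_
      simp only [Kernel.comap_apply, hYs]
      exact hint ω
    · exact measurableSet_kernel_integrable hΦ.stronglyMeasurable
  · rw [integrable_map_measure hSM.aestronglyMeasurable hYm.aemeasurable]
    refine hb.mono' (hSM.comp_measurable hYm).aestronglyMeasurable (.of_forall fun ω => ?_)
    simp only [Function.comp_apply, Kernel.comap_apply, hYs]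
    rw [Real.norm_of_nonneg (integral_nonneg fun _ => norm_nonneg _)]
    simp only [Real.norm_of_nonneg (hΦ0 _)]
    exact hle ω

/-- Conditioning on `pastHalf` in integrated form: the sample is averaged out with the data `Y`
frozen. `Y` has to determine the sample size, on which the kernel depends. -/
lemma Sampling.setIntegral_eq (h : Sampling μ P m T S) (k : ℕ) {B : Set Ω}
    (hB : MeasurableSet[pastHalf T S k] B) (hY : Measurable[pastHalf T S k] Y)
    (hs : Measurable size) (hYs : ∀ ω, size (Y ω) = (S k ω).1)
    {E : Type*} [NormedAddCommGroup E] [NormedSpace ℝ E] {Φ : α × Sample Ξ → E}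
    (hΦ : StronglyMeasurable Φ) (hint : Integrable (fun ω => Φ (Y ω, S k ω)) μ) :
    ∫ ω in B, Φ (Y ω, S k ω) ∂μ
      = ∫ ω in B, ∫ s, Φ (Y ω, s) ∂(sampleKernel P (S k ω).1) ∂μ := by
  have hYm : Measurable Y := hY.mono (h.pastHalf_le k) le_rfl
  have hmap := h.map_prodMk k hB hY hs hYs
  have hpair : Measurable (fun ω => (Y ω, S k ω)) := hYm.prodMk (h.measurable_S k)
  have hi : Integrable Φ ((μ.restrict B).map (fun ω => (Y ω, S k ω))) := by
    rw [integrable_map_measure hΦ.aestronglyMeasurable hpair.aemeasurable]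
    exact hint.integrableOn
  rw [← integral_map (f := Φ) hpair.aemeasurable hΦ.aestronglyMeasurable]
  rw [hmap] at hi ⊢
  rw [Measure.integral_compProd hi, integral_map hYm.aemeasurable]
  · simp only [Kernel.comap_apply, hYs]
  · exact (StronglyMeasurable.integral_kernel_prod_right' hΦ).aestronglyMeasurable

/-- Integration over the directions of iteration `k`, which are independent of the past. -/
lemma Sampling.setIntegral_directions_eq (h : Sampling μ P m T S) (k : ℕ) {B : Set Ω}
    (hB : MeasurableSet[past T S k] B) (hY : Measurable[past T S k] Y)
    {Φ : α × (Fin (N k) → Vec d) → ℝ}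
    (hΦ : Measurable Φ) (hint : Integrable (fun ω => Φ (Y ω, T k ω)) μ) :
    ∫ ω in B, Φ (Y ω, T k ω) ∂μ = ∫ ω in B, ∫ u, Φ (Y ω, u) ∂(μ.map (T k)) ∂μ ∧
    Integrable (fun ω => ∫ u, Φ (Y ω, u) ∂(μ.map (T k))) μ := by
  have hYm : Measurable Y := hY.mono (h.past_le k) le_rfl
  have hT := h.measurable_T k
  have := Measure.isProbabilityMeasure_map (μ := μ) hT.aemeasurable
  have hpair : Measurable (fun ω => (Y ω, T k ω)) := hYm.prodMk hT
  have hmap : ∀ B, MeasurableSet[past T S k] B → (μ.restrict B).map (fun ω => (Y ω, T k ω))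
      = ((μ.restrict B).map Y).prod (μ.map (T k)) := by
    intro B hB
    refine (Measure.prod_eq fun s t hs ht => ?_).symm
    rw [Measure.map_apply hpair (hs.prod ht), Measure.map_apply hYm hs, Measure.map_apply hT ht,
      Measure.restrict_apply (hpair (hs.prod ht)), Measure.restrict_apply (hYm hs)]
    have := (Indep_iff _ _ μ).1 (h.indep_T k) (T k ⁻¹' t) (Y ⁻¹' s ∩ B) ⟨t, ht, rfl⟩
      ((hY hs).inter hB)
    rw [mul_comm, ← this]
    congr 1
    ext ω
    simp only [Set.mem_inter_iff, Set.mem_preimage, Set.mem_prod]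
    tauto
  have hi : ∀ B, MeasurableSet[past T S k] B →
      Integrable Φ (((μ.restrict B).map Y).prod (μ.map (T k))) := by
    intro B hB
    rw [← hmap B hB, integrable_map_measure hΦ.aestronglyMeasurable hpair.aemeasurable]
    exact hint.integrableOn
  constructor
  · rw [← integral_map (f := Φ) hpair.aemeasurable hΦ.aestronglyMeasurable, hmap B hB,
      integral_prod _ (hi B hB), integral_map hYm.aemeasurable]
    exact hΦ.stronglyMeasurable.integral_prod_right'.aestronglyMeasurable
  · have := (hi Set.univ MeasurableSet.univ).integral_prod_left
    rw [Measure.restrict_univ] at this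
    exact this.comp_measurable hYm

end Kernel

end CFD

namespace CFD

attribute [local irreducible] gradEst

/-! ### Moments of the estimator over the sample. -/

section Estimator

variable {d N : ℕ} {Ξ : Type*} [MeasurableSpace Ξ] {f : Vec d → Ξ → ℝ}

lemma measurable_gradEst {Z : Type*} [MeasurableSpace Z] {g : Vec d → Z → ℝ}
    (hc : ∀ z, Continuous fun x => g x z) (hm : ∀ x, Measurable (g x)) (ν γ : ℝ) :
    Measurable fun p : (Vec d × (Fin N → Vec d)) × Z =>
      gradEst (fun y => g y p.2) ν γ p.1.2 p.1.1 := by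
  have hg : Measurable (Function.uncurry g) := measurable_uncurry_of_continuous_of_measurable hc hm
  unfold gradEst
  refine (Finset.measurable_sum _ fun j _ => ?_).const_smul γ
  have hj : Measurable fun p : (Vec d × (Fin N → Vec d)) × Z => p.1.2 j := by fun_prop
  have h1 : Measurable fun p : (Vec d × (Fin N → Vec d)) × Z => g (p.1.1 + ν • p.1.2 j) p.2 :=
    hg.comp ((measurable_fst.fst.add (hj.const_smul ν)).prodMk measurable_snd)
  have h2 : Measurable fun p : (Vec d × (Fin N → Vec d)) × Z => g (p.1.1 - ν • p.1.2 j) p.2 :=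
    hg.comp ((measurable_fst.fst.sub (hj.const_smul ν)).prodMk measurable_snd)
  exact ((h1.sub h2).div_const _).smul hj

lemma measurable_gradEst_apply {φ : Vec d → ℝ} (hc : Continuous φ) (ν γ : ℝ) :
    Measurable fun p : Vec d × (Fin N → Vec d) => gradEst φ ν γ p.2 p.1 :=
  have h : Measurable fun p : Vec d × (Fin N → Vec d) => (p, ()) := by fun_prop
  (measurable_gradEst (Z := Unit) (g := fun x _ => φ x) (fun _ => hc) (fun _ => measurable_const)
    ν γ).comp h

lemma continuous_subsampled (hc : ∀ ζ, Continuous fun x => f x ζ) (s : Sample Ξ) :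
    Continuous (subsampled f s) := by
  unfold subsampled
  fun_prop

lemma measurable_subsampled (hm : ∀ x, Measurable (f x)) (x : Vec d) :
    Measurable fun s : Sample Ξ => subsampled f s x := by
  rw [measurable_sample_iff]
  intro n
  change Measurable fun z : Fin n → Ξ => 1 / (n : ℝ) * ∑ i, f x (z i)
  exact (Finset.measurable_sum _ fun i _ => (hm x).comp (measurable_pi_apply i)).const_mul _

lemma gradEst_subsampled (ν γ : ℝ) (u : Fin N → Vec d) (x : Vec d) (s : Sample Ξ) :
    gradEst (subsampled f s) ν γ u x
      = (1 / (s.1 : ℝ)) • ∑ i, gradEst (fun y => f y (s.2 i)) ν γ u x := by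
  simp only [gradEst, subsampled, Finset.smul_sum, smul_smul]
  rw [Finset.sum_comm]
  refine Finset.sum_congr rfl fun j _ => ?_
  rw [← Finset.sum_smul]
  congr 1
  simp only [← Finset.mul_sum, ← Finset.sum_div, Finset.sum_sub_distrib]
  ring

lemma gradEst_eq_sum_dirTerm {φ : Vec d → ℝ} (ν γ : ℝ) (u : Fin N → Vec d) (x : Vec d) :
    gradEst φ ν γ u x = γ • ∑ j, dirTerm (gradient φ x) (diffErr φ ν x) (u j) := by
  simp [gradEst, dirTerm, diffErr]

variable {P : Measure Ξ} [IsProbabilityMeasure P] {Lf Mf : ℝ}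

lemma WellPosed.integral_gradEst (hf : WellPosed P f) (ν γ : ℝ) (u : Fin N → Vec d) (x : Vec d) :
    ∫ ζ, gradEst (fun y => f y ζ) ν γ u x ∂P = gradEst (objective P f) ν γ u x := by
  have h1 : ∀ j, Integrable (fun ζ => (f (x + ν • u j) ζ - f (x - ν • u j) ζ) / (2 * ν)) P :=
    fun j => ((hf.integrable _).sub (hf.integrable _)).div_const _
  simp only [gradEst, objective]
  rw [integral_smul, integral_finsetSum _ fun j _ => (h1 j).smul_const _]
  simp only [integral_smul_const, integral_div,
    integral_sub (hf.integrable _) (hf.integrable _)]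

/-- A polynomial weight dominating the size of the estimator along the directions `u`. -/
noncomputable def dirWeight (u : Fin N → Vec d) : ℝ := (∑ j, (1 + ‖u j‖) ^ 3) ^ 2

lemma Smoothness.norm_gradEst_le (hd : 1 ≤ d) (hs : Smoothness P f Lf Mf) {ν : ℝ} (hν : 0 < ν)
    (γ : ℝ) (u : Fin N → Vec d) (x : Vec d) (ζ : Ξ) :
    ‖gradEst (fun y => f y ζ) ν γ u x‖
      ≤ |γ| * (1 + Lf * ν) * (‖gradient (fun y => f y ζ) x‖ + 1) * ∑ j, (1 + ‖u j‖) ^ 3 := by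
  have hL := (hs.gradLipschitz ζ).nonneg hd
  rw [gradEst, norm_smul, Real.norm_eq_abs, mul_assoc |γ|, mul_assoc |γ|]
  refine mul_le_mul_of_nonneg_left ?_ (abs_nonneg γ)
  rw [Finset.mul_sum]
  refine (norm_sum_le _ _).trans (Finset.sum_le_sum fun j _ => ?_)
  rw [norm_smul, Real.norm_eq_abs]
  have h1 := (hs.gradLipschitz ζ).abs_symm_diff_le (hs.contDiff ζ) hL hν x (u j)
  set G := ‖gradient (fun y => f y ζ) x‖ with hG
  have hG0 : 0 ≤ G := norm_nonneg _
  set U := ‖u j‖ with hU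
  have hU0 : 0 ≤ U := norm_nonneg _
  have hU2 : U ^ 2 ≤ (1 + U) ^ 3 := by nlinarith [pow_nonneg hU0 3, pow_nonneg hU0 2]
  have hU3 : U ^ 3 ≤ (1 + U) ^ 3 := by gcongr; linarith
  calc _ ≤ ((G + Lf * ν * U) * U) * U := by gcongr
    _ = G * U ^ 2 + Lf * ν * U ^ 3 := by ring
    _ ≤ G * (1 + U) ^ 3 + Lf * ν * (1 + U) ^ 3 := by gcongr
    _ ≤ _ := by
      rw [← add_mul]
      gcongr
      nlinarith [mul_nonneg (mul_nonneg hL hν.le) hG0]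

/-- Second moment bound for the estimator with a single sample. -/
lemma exists_integral_norm_gradEst_sq_le (hd : 1 ≤ d) (hf : WellPosed P f)
    (hs : Smoothness P f Lf Mf) (hvar : BoundedVariance P f) {ν : ℝ} (hν : 0 < ν) (γ : ℝ) :
    ∃ C : ℝ, 0 ≤ C ∧ ∀ (x : Vec d) (u : Fin N → Vec d),
      MemLp (fun ζ => gradEst (fun y => f y ζ) ν γ u x) 2 P ∧
      ∫ ζ, ‖gradEst (fun y => f y ζ) ν γ u x‖ ^ 2 ∂P ≤ C * (dirWeight u * (1 + ‖x‖ ^ 2)) := by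
  obtain ⟨β₁, β₂, hβ₁, hβ₂, hV⟩ := hvar
  have hLF := hs.gradLipschitz_objective hd hf
  have hL := hLF.nonneg hd
  set G0 := ‖gradient (objective P f) 0‖
  set c := (|γ| * (1 + Lf * ν)) ^ 2 with hc
  -- The `3` comes from `(p + q + 1)² ≤ 3 (p² + q² + 1)`, with `q = ‖∇F(x)‖` and `p` the deviation
  -- of the stochastic gradient; the inner factor bounds `q²` through `‖∇F(x)‖ ≤ G0 + Lf ‖x‖`.
  set C0 := 3 * ((β₁ + 1) * (2 * G0 ^ 2 + 2 * Lf ^ 2) + β₂ + 1) with hC0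
  refine ⟨c * C0, by positivity, fun x u => ?_⟩
  set V := fun ζ => ‖gradient (fun y => f y ζ) x - gradient (objective P f) x‖ ^ 2 with hVdef
  have hpt : ∀ ζ, ‖gradEst (fun y => f y ζ) ν γ u x‖ ^ 2
      ≤ c * dirWeight u * (3 * (V ζ + (‖gradient (objective P f) x‖ ^ 2 + 1))) := by
    intro ζ
    have h1 := hs.norm_gradEst_le hd hν γ u x ζ
    have h2 : (‖gradient (fun y => f y ζ) x‖ + 1) ^ 2
        ≤ 3 * (V ζ + (‖gradient (objective P f) x‖ ^ 2 + 1)) := by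
      have h3 := norm_le_norm_add_norm_sub' (gradient (fun y => f y ζ) x)
        (gradient (objective P f) x)
      simp only [hVdef]
      set p := ‖gradient (fun y => f y ζ) x - gradient (objective P f) x‖
      set q := ‖gradient (objective P f) x‖
      calc (‖gradient (fun y => f y ζ) x‖ + 1) ^ 2 ≤ (q + p + 1) ^ 2 := by gcongr
        _ ≤ _ := by nlinarith [sq_nonneg (q - p), sq_nonneg (q - 1), sq_nonneg (p - 1)]
    calc _ ≤ (|γ| * (1 + Lf * ν) * (‖gradient (fun y => f y ζ) x‖ + 1)
          * ∑ j, (1 + ‖u j‖) ^ 3) ^ 2 := by gcongr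
      _ = c * dirWeight u * (‖gradient (fun y => f y ζ) x‖ + 1) ^ 2 := by
        rw [hc, dirWeight]; ring
      _ ≤ _ := by
        have : 0 ≤ dirWeight u := sq_nonneg _
        gcongr
  have hbi : Integrable (fun ζ => c * dirWeight u
      * (3 * (V ζ + (‖gradient (objective P f) x‖ ^ 2 + 1)))) P :=
    (((hV x).1.add (integrable_const _)).const_mul _).const_mul _
  have hmeas : Measurable fun ζ => gradEst (fun y => f y ζ) ν γ u x :=
    (measurable_gradEst (fun ζ => (hs.contDiff ζ).continuous) hf.measurable ν γ).comp
      (measurable_prodMk_left (x := (x, u)))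
  have hint : Integrable (fun ζ => ‖gradEst (fun y => f y ζ) ν γ u x‖ ^ 2) P :=
    hbi.mono' (hmeas.norm.pow_const 2).aestronglyMeasurable (.of_forall fun ζ => by
      rw [Real.norm_of_nonneg (by positivity)]; exact hpt ζ)
  refine ⟨(memLp_two_iff_integrable_sq_norm hmeas.aestronglyMeasurable).2 hint, ?_⟩
  refine (integral_mono hint hbi hpt).trans ?_
  rw [integral_const_mul, integral_const_mul, integral_add (hV x).1 (integrable_const _)]
  simp only [integral_const, probReal_univ, one_smul]
  have hg : ‖gradient (objective P f) x‖ ^ 2 ≤ (2 * G0 ^ 2 + 2 * Lf ^ 2) * (1 + ‖x‖ ^ 2) := by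
    have h1 := hLF.norm_gradient_le x
    calc _ ≤ (G0 + Lf * ‖x‖) ^ 2 := by gcongr
      _ ≤ 2 * G0 ^ 2 + 2 * (Lf * ‖x‖) ^ 2 := by nlinarith [sq_nonneg (G0 - Lf * ‖x‖)]
      _ ≤ _ := by nlinarith [sq_nonneg (G0 * ‖x‖), sq_nonneg Lf]
  have hw : 0 ≤ dirWeight u := sq_nonneg _
  calc _ ≤ c * dirWeight u * (3 * ((β₁ * ‖gradient (objective P f) x‖ ^ 2 + β₂)
        + (‖gradient (objective P f) x‖ ^ 2 + 1))) := by
        gcongr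
        exact (hV x).2
    _ = c * dirWeight u * (3 * ((β₁ + 1) * ‖gradient (objective P f) x‖ ^ 2 + (β₂ + 1))) := by ring
    _ ≤ c * dirWeight u * (3 * ((β₁ + 1) * ((2 * G0 ^ 2 + 2 * Lf ^ 2) * (1 + ‖x‖ ^ 2))
        + (β₂ + 1) * (1 + ‖x‖ ^ 2))) := by
        gcongr
        nlinarith [sq_nonneg ‖x‖]
    _ = _ := by rw [hC0]; ring

lemma integrable_dirWeight {m : Scheme} (hd : 1 ≤ d) {τ : Measure (Fin N → Vec d)}
    [IsProbabilityMeasure τ] (h : IsDirectionLaw m τ) : Integrable dirWeight τ := by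
  -- Cauchy–Schwarz over the directions and `(1 + r)⁶ ≤ 32 (1 + r⁶)` reduce the weight to sixth
  -- moments.
  have hb : Integrable (fun u : Fin N → Vec d => (N : ℝ) * ∑ j, 32 * (1 + ‖u j‖ ^ 6)) τ :=
    (integrable_finsetSum _ fun j _ =>
      ((integrable_const _).add (h.integrable_norm_pow hd j 6)).const_mul _).const_mul _
  refine hb.mono' (Continuous.aestronglyMeasurable (by unfold dirWeight; fun_prop))
    (.of_forall fun u => ?_)
  have h0 : 0 ≤ dirWeight u := sq_nonneg _
  rw [Real.norm_of_nonneg h0, dirWeight]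
  have := sq_sum_le_card_mul_sum_sq (s := Finset.univ) (f := fun j => (1 + ‖u j‖) ^ 3)
  rw [Finset.card_univ, Fintype.card_fin] at this
  refine this.trans ?_
  gcongr with j
  have := add_pow_le (zero_le_one' ℝ) (norm_nonneg (u j)) 6
  norm_num at this
  rw [← pow_mul]
  exact this

variable {ν γ : ℝ} {u : Fin N → Vec d} {x : Vec d}

lemma integral_sampleKernel {E : Type*} [NormedAddCommGroup E] [NormedSpace ℝ E] (n : ℕ)
    {g : Sample Ξ → E} (hg : StronglyMeasurable g) :
    ∫ s, g s ∂(sampleKernel P n) = ∫ z : Fin n → Ξ, g ⟨n, z⟩ ∂(Measure.pi fun _ => P) := by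
  rw [sampleKernel_apply, integral_map (measurable_sigma_mk n).aemeasurable
    hg.aestronglyMeasurable]

lemma stronglyMeasurable_gradEst_subsampled (hc : ∀ ζ, Continuous fun x => f x ζ)
    (hm : ∀ x, Measurable (f x)) (ν γ : ℝ) (u : Fin N → Vec d) (x : Vec d) :
    StronglyMeasurable fun s : Sample Ξ => gradEst (subsampled f s) ν γ u x :=
  ((measurable_gradEst (g := fun y s => subsampled f s y) (continuous_subsampled hc)
    (measurable_subsampled hm) ν γ).comp
      (measurable_prodMk_left (x := (x, u)))).stronglyMeasurable

lemma integrable_gradEst_eval (hw : MemLp (fun ζ => gradEst (fun y => f y ζ) ν γ u x) 2 P)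
    {n : ℕ} (i : Fin n) : Integrable
      (fun z : Fin n → Ξ => gradEst (fun y => f y (z i)) ν γ u x) (Measure.pi fun _ => P) :=
  (measurePreserving_eval (fun _ : Fin n => P) i).integrable_comp_of_integrable
    (hw.integrable (by norm_num))

lemma integrable_sampleKernel_gradEst (hc : ∀ ζ, Continuous fun x => f x ζ)
    (hm : ∀ x, Measurable (f x))
    (hw : MemLp (fun ζ => gradEst (fun y => f y ζ) ν γ u x) 2 P) (n : ℕ) :
    Integrable (fun s => gradEst (subsampled f s) ν γ u x) (sampleKernel P n) ∧
    Integrable (fun s => ‖gradEst (subsampled f s) ν γ u x‖ ^ 2) (sampleKernel P n) := by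
  have hsm := stronglyMeasurable_gradEst_subsampled hc hm ν γ u x
  constructor
  · rw [sampleKernel_apply, integrable_map_measure hsm.aestronglyMeasurable
      (measurable_sigma_mk n).aemeasurable]
    have hi : Integrable (fun z : Fin n → Ξ => (1 / (n : ℝ)) •
        ∑ i, gradEst (fun y => f y (z i)) ν γ u x) (Measure.pi fun _ => P) :=
      (integrable_finsetSum _ fun i _ => integrable_gradEst_eval hw i).smul (1 / (n : ℝ))
    exact hi.congr (.of_forall fun z => (gradEst_subsampled ν γ u x ⟨n, z⟩).symm)
  · have hsm2 : StronglyMeasurable fun s : Sample Ξ =>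
        ‖gradEst (subsampled f s) ν γ u x‖ ^ 2 := hsm.norm.pow 2
    rw [sampleKernel_apply, integrable_map_measure hsm2.aestronglyMeasurable
      (measurable_sigma_mk n).aemeasurable]
    simp only [Function.comp_def, gradEst_subsampled, norm_smul, mul_pow]
    exact (integral_norm_sum_sq_pi hw n).1.const_mul _

/-- Mean of the estimator over the sample. -/
lemma integral_sampleKernel_gradEst (hf : WellPosed P f) (hc : ∀ ζ, Continuous fun x => f x ζ)
    (hw : MemLp (fun ζ => gradEst (fun y => f y ζ) ν γ u x) 2 P) {n : ℕ} (hn : 1 ≤ n) :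
    ∫ s, gradEst (subsampled f s) ν γ u x ∂(sampleKernel P n)
      = gradEst (objective P f) ν γ u x := by
  have hn0 : (n : ℝ) ≠ 0 := by positivity
  rw [integral_sampleKernel n (stronglyMeasurable_gradEst_subsampled hc hf.measurable ν γ u x)]
  have hsum := integral_finsetSum (μ := Measure.pi fun _ : Fin n => P) Finset.univ
    (f := fun (i : Fin n) (z : Fin n → Ξ) => gradEst (fun y => f y (z i)) ν γ u x)
    fun i _ => integrable_gradEst_eval hw i
  simp only [gradEst_subsampled]
  rw [integral_smul, hsum]
  have : ∀ i : Fin n, ∫ z : Fin n → Ξ, gradEst (fun y => f y (z i)) ν γ u x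
      ∂(Measure.pi fun _ => P) = gradEst (objective P f) ν γ u x := fun i =>
    (integral_comp_eval (μ := fun _ : Fin n => P) (i := i) hw.1).trans (hf.integral_gradEst ν γ u x)
  simp only [this, Finset.sum_const, Finset.card_univ, Fintype.card_fin,
    ← Nat.cast_smul_eq_nsmul ℝ, smul_smul]
  rw [one_div, inv_mul_cancel₀ hn0, one_smul]

lemma integral_norm_gradEst_sub_sq (hf : WellPosed P f)
    (hw : MemLp (fun ζ => gradEst (fun y => f y ζ) ν γ u x) 2 P) :
    ∫ ζ, ‖gradEst (fun y => f y ζ) ν γ u x - gradEst (objective P f) ν γ u x‖ ^ 2 ∂P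
      = ∫ ζ, ‖gradEst (fun y => f y ζ) ν γ u x‖ ^ 2 ∂P
        - ‖gradEst (objective P f) ν γ u x‖ ^ 2 := by
  have hi := hw.integrable (by norm_num)
  have h1 : Integrable (fun ζ => 2 * inner ℝ (gradEst (objective P f) ν γ u x)
      (gradEst (fun y => f y ζ) ν γ u x)) P := (hi.const_inner _).const_mul 2
  have h2 : Integrable (fun ζ => ‖gradEst (fun y => f y ζ) ν γ u x‖ ^ 2) P :=
    hw.integrable_norm_pow'
  have h3 : ∀ ζ, ‖gradEst (fun y => f y ζ) ν γ u x - gradEst (objective P f) ν γ u x‖ ^ 2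
      = ‖gradEst (fun y => f y ζ) ν γ u x‖ ^ 2
        - 2 * inner ℝ (gradEst (objective P f) ν γ u x) (gradEst (fun y => f y ζ) ν γ u x)
        + ‖gradEst (objective P f) ν γ u x‖ ^ 2 := by
    intro ζ
    rw [norm_sub_sq_real, real_inner_comm]
  have h4 : Integrable (fun ζ => ‖gradEst (fun y => f y ζ) ν γ u x‖ ^ 2
        - 2 * inner ℝ (gradEst (objective P f) ν γ u x) (gradEst (fun y => f y ζ) ν γ u x)) P :=
    h2.sub h1
  simp only [h3]
  rw [integral_add h4 (integrable_const _), integral_sub h2 h1, integral_const_mul,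
    integral_inner hi, hf.integral_gradEst, real_inner_self_eq_norm_sq]
  simp
  ring

/-- Second moment of the estimator over the sample. -/
lemma integral_sampleKernel_norm_gradEst_sq (hf : WellPosed P f)
    (hc : ∀ ζ, Continuous fun x => f x ζ)
    (hw : MemLp (fun ζ => gradEst (fun y => f y ζ) ν γ u x) 2 P) {n : ℕ} (hn : 1 ≤ n) :
    ∫ s, ‖gradEst (subsampled f s) ν γ u x‖ ^ 2 ∂(sampleKernel P n)
      = ‖gradEst (objective P f) ν γ u x‖ ^ 2
        + (∫ ζ, ‖gradEst (fun y => f y ζ) ν γ u x - gradEst (objective P f) ν γ u x‖ ^ 2 ∂P) / n := by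
  have hn0 : (n : ℝ) ≠ 0 := by positivity
  have hsm : StronglyMeasurable fun s : Sample Ξ => ‖gradEst (subsampled f s) ν γ u x‖ ^ 2 :=
    (stronglyMeasurable_gradEst_subsampled hc hf.measurable ν γ u x).norm.pow 2
  rw [integral_sampleKernel n hsm]
  simp only [gradEst_subsampled, norm_smul, mul_pow]
  -- Dividing `n 𝔼‖g‖² + n (n - 1) ‖𝔼 g‖²` by `n²` leaves the squared mean plus the variance over
  -- `n`.
  rw [integral_const_mul, (integral_norm_sum_sq_pi hw n).2, hf.integral_gradEst,
    integral_norm_gradEst_sub_sq hf hw, Real.norm_of_nonneg (by positivity)]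
  field_simp
  ring

/-- Averaging does not increase the second moment, so the bound is uniform in the random sample
size. -/
lemma integral_sampleKernel_norm_gradEst_sq_le (hf : WellPosed P f)
    (hc : ∀ ζ, Continuous fun x => f x ζ)
    (hw : MemLp (fun ζ => gradEst (fun y => f y ζ) ν γ u x) 2 P) {n : ℕ} (hn : 1 ≤ n) :
    ∫ s, ‖gradEst (subsampled f s) ν γ u x‖ ^ 2 ∂(sampleKernel P n)
      ≤ ∫ ζ, ‖gradEst (fun y => f y ζ) ν γ u x‖ ^ 2 ∂P := by
  rw [integral_sampleKernel_norm_gradEst_sq hf hc hw hn]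
  have h0 : 0 ≤ ∫ ζ, ‖gradEst (fun y => f y ζ) ν γ u x
      - gradEst (objective P f) ν γ u x‖ ^ 2 ∂P := integral_nonneg fun _ => by positivity
  have := div_le_self h0 (by exact_mod_cast hn : (1 : ℝ) ≤ n)
  rw [integral_norm_gradEst_sub_sq hf hw] at this ⊢
  linarith

end Estimator

end CFD

namespace CFD

attribute [local irreducible] gradEst

/-! ### Measurability and square integrability of the iterates. -/

section Descent

variable {Ω Ξ : Type*} [mΩ : MeasurableSpace Ω] [MeasurableSpace Ξ] {μ : Measure Ω}
  [IsProbabilityMeasure μ] {P : Measure Ξ} [IsProbabilityMeasure P] {m : Scheme} {d : ℕ}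
  {f : Vec d → Ξ → ℝ} {Lf Mf ν : ℝ} {N : ℕ → ℕ} {T : (k : ℕ) → Ω → Fin (N k) → Vec d}
  {S : ℕ → Ω → Sample Ξ} {α : ℕ → ℝ} {x₀ : Vec d}

lemma past_mono_succ (T : (k : ℕ) → Ω → Fin (N k) → Vec d) (S : ℕ → Ω → Sample Ξ) (k : ℕ) :
    past T S k ≤ past T S (k + 1) :=
  iSup_le fun j => le_iSup (fun j : Fin (k + 1) => MeasurableSpace.comap (T j) inferInstance ⊔
    MeasurableSpace.comap (S j) inferInstance) j.castSucc

lemma comap_sup_comap_le_past_succ (T : (k : ℕ) → Ω → Fin (N k) → Vec d) (S : ℕ → Ω → Sample Ξ)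
    (k : ℕ) : MeasurableSpace.comap (T k) inferInstance ⊔
      MeasurableSpace.comap (S k) inferInstance ≤ past T S (k + 1) :=
  le_iSup (fun j : Fin (k + 1) => MeasurableSpace.comap (T j) inferInstance ⊔
    MeasurableSpace.comap (S j) inferInstance) (Fin.last k)

lemma Smoothness.measurable_gradEst_subsampled (hf : WellPosed P f) (hs : Smoothness P f Lf Mf)
    (n : ℕ) (ν γ : ℝ) : Measurable fun p : (Vec d × (Fin n → Vec d)) × Sample Ξ =>
      gradEst (subsampled f p.2) ν γ p.1.2 p.1.1 :=
  measurable_gradEst (g := fun y s => subsampled f s y)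
    (continuous_subsampled fun ζ => (hs.contDiff ζ).continuous)
    (measurable_subsampled hf.measurable) ν γ

lemma measurable_iter (hf : WellPosed P f) (hs : Smoothness P f Lf Mf) (k : ℕ) :
    Measurable[past T S k] (iter m f ν α T S x₀ k) := by
  induction k with
  | zero => exact measurable_const
  | succ k ih =>
    have hX : Measurable[past T S (k + 1)] (iter m f ν α T S x₀ k) :=
      ih.mono (past_mono_succ T S k) le_rfl
    have hT : Measurable[past T S (k + 1)] (T k) := measurable_iff_comap_le.2
      (le_sup_left.trans (comap_sup_comap_le_past_succ T S k))
    have hS : Measurable[past T S (k + 1)] (S k) := measurable_iff_comap_le.2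
      (le_sup_right.trans (comap_sup_comap_le_past_succ T S k))
    have hg : Measurable[past T S (k + 1)] fun ω => gradEst (subsampled f (S k ω)) ν
        (scaling m d (N k)) (T k ω) (iter m f ν α T S x₀ k ω) :=
      (hs.measurable_gradEst_subsampled hf (N k) ν (scaling m d (N k))).comp
        ((hX.prodMk hT).prodMk hS)
    exact hX.sub (hg.const_smul (α k))

/-- The data of iteration `k` known before the sample is drawn. -/
noncomputable def iterData (m : Scheme) (f : Vec d → Ξ → ℝ) (ν : ℝ) (α : ℕ → ℝ)
    (T : (k : ℕ) → Ω → Fin (N k) → Vec d) (S : ℕ → Ω → Sample Ξ) (x₀ : Vec d) (k : ℕ) (ω : Ω) :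
    (Vec d × (Fin (N k) → Vec d)) × ℕ :=
  ((iter m f ν α T S x₀ k ω, T k ω), (S k ω).1)

lemma measurable_iter_directions (hf : WellPosed P f) (hs : Smoothness P f Lf Mf) (k : ℕ) :
    Measurable[pastHalf T S k] fun ω => (iter m f ν α T S x₀ k ω, T k ω) := by
  have hX : Measurable[pastHalf T S k] (iter m f ν α T S x₀ k) :=
    (measurable_iter hf hs k).mono le_sup_left le_rfl
  have hT : Measurable[pastHalf T S k] (T k) := measurable_iff_comap_le.2 le_sup_right
  exact hX.prodMk hT

lemma Sampling.measurable_iterData (h : Sampling μ P m T S) (hf : WellPosed P f)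
    (hs : Smoothness P f Lf Mf) (k : ℕ) :
    Measurable[pastHalf T S k] (iterData m f ν α T S x₀ k) := by
  have hn : Measurable[pastHalf T S k] fun ω => (S k ω).1 :=
    (h.size_past k).mono le_sup_left le_rfl
  exact (measurable_iter_directions hf hs k).prodMk hn

lemma Sampling.indepFun_directions_iter (h : Sampling μ P m T S) (hf : WellPosed P f)
    (hs : Smoothness P f Lf Mf) (k : ℕ) : IndepFun (T k) (iter m f ν α T S x₀ k) μ :=
  indep_of_indep_of_le_right (h.indep_T k) (measurable_iff_comap_le.1 (measurable_iter hf hs k))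

/-- The new directions are independent of the current iterate, so integrability of the two factors
suffices. -/
lemma Sampling.integrable_dirWeight_mul (hd : 1 ≤ d) (h : Sampling μ P m T S)
    (hf : WellPosed P f) (hs : Smoothness P f Lf Mf) (k : ℕ)
    (hX : Integrable (fun ω => ‖iter m f ν α T S x₀ k ω‖ ^ 2) μ) :
    Integrable (fun ω => dirWeight (T k ω) * (1 + ‖iter m f ν α T S x₀ k ω‖ ^ 2)) μ := by
  have hT := h.measurable_T k
  have := Measure.isProbabilityMeasure_map (μ := μ) hT.aemeasurable
  have h1 : Integrable (fun ω => dirWeight (T k ω)) μ :=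
    (integrable_dirWeight hd (h.law_T k)).comp_measurable hT
  have h2 : Integrable (fun ω => 1 + ‖iter m f ν α T S x₀ k ω‖ ^ 2) μ :=
    (integrable_const 1).add hX
  have hw : Measurable (dirWeight : (Fin (N k) → Vec d) → ℝ) :=
    Continuous.measurable (by unfold dirWeight; fun_prop)
  have hx : Measurable fun x : Vec d => 1 + ‖x‖ ^ 2 := by fun_prop
  exact ((h.indepFun_directions_iter hf hs k).comp hw hx).integrable_mul h1 h2

lemma Sampling.integrable_norm_gradEst_sq (hd : 1 ≤ d) (h : Sampling μ P m T S)
    (hf : WellPosed P f) (hs : Smoothness P f Lf Mf) (hvar : BoundedVariance P f) (hν : 0 < ν)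
    (k : ℕ) (hX : Integrable (fun ω => ‖iter m f ν α T S x₀ k ω‖ ^ 2) μ) :
    Integrable (fun ω => ‖gradEst (subsampled f (S k ω)) ν (scaling m d (N k)) (T k ω)
      (iter m f ν α T S x₀ k ω)‖ ^ 2) μ := by
  obtain ⟨C, hC, hb⟩ := exists_integral_norm_gradEst_sq_le (N := N k) hd hf hs hvar hν
    (scaling m d (N k))
  have hc : ∀ ζ, Continuous fun x => f x ζ := fun ζ => (hs.contDiff ζ).continuous
  have hΦ : Measurable fun p : ((Vec d × (Fin (N k) → Vec d)) × ℕ) × Sample Ξ =>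
      ‖gradEst (subsampled f p.2) ν (scaling m d (N k)) p.1.1.2 p.1.1.1‖ ^ 2 :=
    ((hs.measurable_gradEst_subsampled hf (N k) ν (scaling m d (N k))).comp
      (measurable_fst.fst.prodMk measurable_snd)).norm.pow_const 2
  exact h.integrable_of_kernel k (h.measurable_iterData hf hs k) measurable_snd (fun _ => rfl) hΦ
    (fun _ => by positivity)
    (fun ω => (integrable_sampleKernel_gradEst hc hf.measurable (hb _ _).1 _).2)
    ((h.integrable_dirWeight_mul hd hf hs k hX).const_mul C)
    (fun ω => (integral_sampleKernel_norm_gradEst_sq_le hf hc (hb _ _).1 (h.size_pos k ω)).trans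
      (hb _ _).2)

/-- Given the current iterate and directions, the second moment of the estimator is at most a
constant times `dirWeight` times `1 + ‖x_k‖²`, so square integrability propagates by induction. -/
lemma Sampling.integrable_norm_iter_sq (hd : 1 ≤ d) (h : Sampling μ P m T S)
    (hf : WellPosed P f) (hs : Smoothness P f Lf Mf) (hvar : BoundedVariance P f) (hν : 0 < ν)
    (k : ℕ) : Integrable (fun ω => ‖iter m f ν α T S x₀ k ω‖ ^ 2) μ := by
  induction k with
  | zero => exact integrable_const (‖x₀‖ ^ 2)
  | succ k ih =>
    have hg := h.integrable_norm_gradEst_sq hd hf hs hvar hν k ih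
    have hm : Measurable (iter m f ν α T S x₀ (k + 1)) :=
      (measurable_iter hf hs (k + 1)).mono (h.past_le _) le_rfl
    refine ((ih.const_mul 2).add (hg.const_mul (2 * α k ^ 2))).mono'
      (hm.norm.pow_const 2).aestronglyMeasurable (.of_forall fun ω => ?_)
    rw [Real.norm_of_nonneg (by positivity)]
    simp only [iter, Pi.add_apply]
    set a := iter m f ν α T S x₀ k ω
    set g := gradEst (subsampled f (S k ω)) ν (scaling m d (N k)) (T k ω) a
    calc ‖a - α k • g‖ ^ 2 ≤ (‖a‖ + ‖α k • g‖) ^ 2 := by gcongr; exact norm_sub_le _ _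
      _ ≤ 2 * ‖a‖ ^ 2 + 2 * ‖α k • g‖ ^ 2 := by nlinarith [sq_nonneg (‖a‖ - ‖α k • g‖)]
      _ = _ := by rw [norm_smul, mul_pow, Real.norm_eq_abs, sq_abs]; ring

section Integrability

variable {X : Ω → Vec d} {φ : Vec d → ℝ} {L : ℝ}

lemma GradLipschitz.integrable_norm_gradient_sq (hd : 1 ≤ d) (hφ : ContDiff ℝ 2 φ)
    (h : GradLipschitz φ L) (hXm : Measurable X) (hX : Integrable (fun ω => ‖X ω‖ ^ 2) μ) :
    Integrable (fun ω => ‖gradient φ (X ω)‖ ^ 2) μ := by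
  have hL := h.nonneg hd
  have hm : Measurable fun ω => gradient φ (X ω) :=
    (contDiff_gradient hφ).continuous.measurable.comp hXm
  refine ((integrable_const (2 * ‖gradient φ 0‖ ^ 2)).add (hX.const_mul (2 * L ^ 2))).mono'
    (hm.norm.pow_const 2).aestronglyMeasurable (.of_forall fun ω => ?_)
  rw [Real.norm_of_nonneg (by positivity)]
  simp only [Pi.add_apply]
  calc _ ≤ (‖gradient φ 0‖ + L * ‖X ω‖) ^ 2 := by gcongr; exact h.norm_gradient_le _
    _ ≤ _ := by nlinarith [sq_nonneg (‖gradient φ 0‖ - L * ‖X ω‖)]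

lemma GradLipschitz.integrable_comp (hφ : ContDiff ℝ 2 φ)
    (h : GradLipschitz φ L) (hXm : Measurable X) (hX : Integrable (fun ω => ‖X ω‖ ^ 2) μ) :
    Integrable (fun ω => φ (X ω)) μ := by
  refine ((integrable_const (|φ 0| + ‖gradient φ 0‖)).add
    (hX.const_mul (‖gradient φ 0‖ + L / 2))).mono'
    (hφ.continuous.measurable.comp hXm).aestronglyMeasurable (.of_forall fun ω => ?_)
  have h1 := h.abs_sub_le hφ 0 (X ω)
  rw [zero_add] at h1
  have h2 := abs_real_inner_le_norm (gradient φ 0) (X ω)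
  have h3 : ‖gradient φ 0‖ * ‖X ω‖ ≤ ‖gradient φ 0‖ * (1 + ‖X ω‖ ^ 2) := by
    gcongr
    nlinarith [sq_nonneg (‖X ω‖ - 1)]
  simp only [Pi.add_apply, Real.norm_eq_abs]
  have h4 : |φ (X ω)| ≤ |φ (X ω) - φ 0 - inner ℝ (gradient φ 0) (X ω)| + |φ 0|
      + |inner ℝ (gradient φ 0) (X ω)| := by
    calc |φ (X ω)| = |(φ (X ω) - φ 0 - inner ℝ (gradient φ 0) (X ω)) + φ 0
          + inner ℝ (gradient φ 0) (X ω)| := by congr 1; ring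
      _ ≤ _ := abs_add_three _ _ _
  linarith

lemma integrable_inner_of_sq {g h : Ω → Vec d} (hgm : Measurable g) (hhm : Measurable h)
    (hg : Integrable (fun ω => ‖g ω‖ ^ 2) μ) (hh : Integrable (fun ω => ‖h ω‖ ^ 2) μ) :
    Integrable (fun ω => inner ℝ (g ω) (h ω)) μ := by
  refine (hg.add hh).mono' (hgm.inner hhm).aestronglyMeasurable (.of_forall fun ω => ?_)
  refine (norm_inner_le_norm _ _).trans ?_
  simp only [Pi.add_apply]
  nlinarith [sq_nonneg (‖g ω‖ - ‖h ω‖), sq_nonneg ‖g ω‖, sq_nonneg ‖h ω‖]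

end Integrability

end Descent

end CFD

namespace CFD

attribute [local irreducible] gradEst

/-! ### The norm condition and the conditional descent inequality. -/

section Descent

variable {Ω Ξ : Type*} [mΩ : MeasurableSpace Ω] [MeasurableSpace Ξ] {μ : Measure Ω}
  [IsProbabilityMeasure μ] {P : Measure Ξ} [IsProbabilityMeasure P] {m : Scheme} {d : ℕ}
  {f : Vec d → Ξ → ℝ} {Lf Mf ν : ℝ} {N : ℕ → ℕ} {T : (k : ℕ) → Ω → Fin (N k) → Vec d}
  {S : ℕ → Ω → Sample Ξ} {α : ℕ → ℝ} {x₀ : Vec d}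

/-- The variance of the estimator with a single sample. -/
noncomputable def estVar (P : Measure Ξ) (f : Vec d → Ξ → ℝ) (ν γ : ℝ) {n : ℕ}
    (p : Vec d × (Fin n → Vec d)) : ℝ :=
  ∫ ζ, ‖gradEst (fun y => f y ζ) ν γ p.2 p.1 - gradEst (objective P f) ν γ p.2 p.1‖ ^ 2 ∂P

lemma estVar_nonneg (ν γ : ℝ) {n : ℕ} (p : Vec d × (Fin n → Vec d)) :
    0 ≤ estVar P f ν γ p := integral_nonneg fun _ => by positivity

lemma Smoothness.measurable_estVar (hf : WellPosed P f) (hs : Smoothness P f Lf Mf) (ν γ : ℝ)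
    (n : ℕ) : Measurable (estVar P f ν γ : Vec d × (Fin n → Vec d) → ℝ) := by
  have h1 : Measurable fun p : (Vec d × (Fin n → Vec d)) × Ξ =>
      gradEst (fun y => f y p.2) ν γ p.1.2 p.1.1 :=
    measurable_gradEst (fun ζ => (hs.contDiff ζ).continuous) hf.measurable ν γ
  have h2 : Measurable fun p : (Vec d × (Fin n → Vec d)) × Ξ =>
      gradEst (objective P f) ν γ p.1.2 p.1.1 :=
    (measurable_gradEst_apply hs.contDiff_objective.continuous ν γ).comp measurable_fst
  exact ((h1.sub h2).norm.pow_const 2).stronglyMeasurable.integral_prod_right'.measurable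

/-- The estimator is a measurable function of the data of the iteration and the sample. -/
lemma Smoothness.measurable_gradEst_iterData (hf : WellPosed P f) (hs : Smoothness P f Lf Mf)
    (n : ℕ) (ν γ : ℝ) :
    Measurable fun p : ((Vec d × (Fin n → Vec d)) × ℕ) × Sample Ξ =>
      gradEst (subsampled f p.2) ν γ p.1.1.2 p.1.1.1 := by
  have hp : Measurable fun p : ((Vec d × (Fin n → Vec d)) × ℕ) × Sample Ξ => (p.1.1, p.2) :=
    measurable_fst.fst.prodMk measurable_snd
  have hc := (hs.measurable_gradEst_subsampled hf n ν γ).comp hp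
  exact hc

/-- Integrability of the data entering the descent inequality. -/
lemma Sampling.integrable_norm_gradEst_objective_sq (hd : 1 ≤ d) (h : Sampling μ P m T S)
    (hf : WellPosed P f) (hs : Smoothness P f Lf Mf) (hvar : BoundedVariance P f) (hν : 0 < ν)
    (k : ℕ) :
    Integrable (fun ω => ‖gradEst (objective P f) ν (scaling m d (N k)) (T k ω)
      (iter m f ν α T S x₀ k ω)‖ ^ 2) μ ∧
    Integrable (fun ω => estVar P f ν (scaling m d (N k))
      (iter m f ν α T S x₀ k ω, T k ω)) μ := by
  obtain ⟨C, hC, hb⟩ := exists_integral_norm_gradEst_sq_le (N := N k) hd hf hs hvar hν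
    (scaling m d (N k))
  have hY : Measurable fun ω => (iter m f ν α T S x₀ k ω, T k ω) :=
    (measurable_iter_directions hf hs k).mono (h.pastHalf_le k) le_rfl
  have hbi := (h.integrable_dirWeight_mul hd hf hs k
    (h.integrable_norm_iter_sq (α := α) (x₀ := x₀) hd hf hs hvar hν k)).const_mul C
  have hG : Measurable fun ω => gradEst (objective P f) ν (scaling m d (N k)) (T k ω)
      (iter m f ν α T S x₀ k ω) :=
    (measurable_gradEst_apply hs.contDiff_objective.continuous ν _).comp hY
  have hV : Measurable fun ω => estVar P f ν (scaling m d (N k))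
      (iter m f ν α T S x₀ k ω, T k ω) := (hs.measurable_estVar hf ν _ (N k)).comp hY
  have hsum : ∀ ω, estVar P f ν (scaling m d (N k)) (iter m f ν α T S x₀ k ω, T k ω)
      + ‖gradEst (objective P f) ν (scaling m d (N k)) (T k ω) (iter m f ν α T S x₀ k ω)‖ ^ 2
      ≤ C * (dirWeight (T k ω) * (1 + ‖iter m f ν α T S x₀ k ω‖ ^ 2)) := by
    intro ω
    have := hb (iter m f ν α T S x₀ k ω) (T k ω)
    rw [estVar, integral_norm_gradEst_sub_sq hf this.1, sub_add_cancel]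
    exact this.2
  constructor
  · refine hbi.mono' (hG.norm.pow_const 2).aestronglyMeasurable (.of_forall fun ω => ?_)
    rw [Real.norm_of_nonneg (by positivity)]
    linarith [hsum ω, estVar_nonneg (P := P) (f := f) ν (scaling m d (N k))
      (iter m f ν α T S x₀ k ω, T k ω)]
  · refine hbi.mono' hV.aestronglyMeasurable (.of_forall fun ω => ?_)
    rw [Real.norm_of_nonneg (estVar_nonneg ν _ _)]
    linarith [hsum ω, sq_nonneg ‖gradEst (objective P f) ν (scaling m d (N k)) (T k ω)
      (iter m f ν α T S x₀ k ω)‖]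

/-- The conditional mean of the estimator is the estimator of the objective. -/
lemma Sampling.gT_ae_eq (hd : 1 ≤ d) (h : Sampling μ P m T S)
    (hf : WellPosed P f) (hs : Smoothness P f Lf Mf) (hvar : BoundedVariance P f) (hν : 0 < ν)
    (k : ℕ) : gT μ m f ν α T S x₀ k =ᵐ[μ] fun ω =>
      gradEst (objective P f) ν (scaling m d (N k)) (T k ω) (iter m f ν α T S x₀ k ω) := by
  obtain ⟨C, hC, hb⟩ := exists_integral_norm_gradEst_sq_le (N := N k) hd hf hs hvar hν
    (scaling m d (N k))
  have hc : ∀ ζ, Continuous fun x => f x ζ := fun ζ => (hs.contDiff ζ).continuous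
  have hest := h.integrable_norm_gradEst_sq hd hf hs hvar hν k
    (h.integrable_norm_iter_sq (α := α) (x₀ := x₀) hd hf hs hvar hν k)
  have hY := h.measurable_iterData (α := α) (x₀ := x₀) (ν := ν) hf hs k
  have hXT := measurable_iter_directions (m := m) (α := α) (x₀ := x₀) (ν := ν) (T := T) (S := S)
    hf hs k
  have hΦ : Measurable fun p : ((Vec d × (Fin (N k) → Vec d)) × ℕ) × Sample Ξ =>
      gradEst (subsampled f p.2) ν (scaling m d (N k)) p.1.1.2 p.1.1.1 :=
    hs.measurable_gradEst_iterData hf (N k) ν (scaling m d (N k))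
  have hem : Measurable fun ω => gradEst (subsampled f (S k ω)) ν (scaling m d (N k)) (T k ω)
      (iter m f ν α T S x₀ k ω) := by
    have hc := hΦ.comp ((hY.mono (h.pastHalf_le k) le_rfl).prodMk (h.measurable_S k))
    exact hc
  have hGm : Measurable[pastHalf T S k] fun ω => gradEst (objective P f) ν (scaling m d (N k))
      (T k ω) (iter m f ν α T S x₀ k ω) :=
    (measurable_gradEst_apply hs.contDiff_objective.continuous ν _).comp hXT
  have hG := (h.integrable_norm_gradEst_objective_sq (α := α) (x₀ := x₀) hd hf hs hvar hν k).1
  have hGi : Integrable (fun ω => gradEst (objective P f) ν (scaling m d (N k))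
      (T k ω) (iter m f ν α T S x₀ k ω)) μ :=
    ((memLp_two_iff_integrable_sq_norm
      (hGm.mono (h.pastHalf_le k) le_rfl).aestronglyMeasurable).2 hG).integrable (by norm_num)
  have hei : Integrable (fun ω => gradEst (subsampled f (S k ω)) ν (scaling m d (N k)) (T k ω)
      (iter m f ν α T S x₀ k ω)) μ :=
    ((memLp_two_iff_integrable_sq_norm hem.aestronglyMeasurable).2 hest).integrable (by norm_num)
  -- The candidate is `pastHalf`-measurable, and over each event of that σ-algebra its integral
  -- agrees with that of the estimator, by averaging over the sample.
  refine (ae_eq_condExp_of_forall_setIntegral_eq (h.pastHalf_le k) hei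
    (fun _ _ _ => hGi.integrableOn) (fun B hB _ => ?_) hGm.stronglyMeasurable.aestronglyMeasurable).symm
  have := h.setIntegral_eq k hB hY measurable_snd (fun _ => rfl) hΦ.stronglyMeasurable hei
  refine Eq.trans ?_ this.symm
  congr 1
  ext1 ω
  exact (integral_sampleKernel_gradEst hf hc (hb _ _).1 (h.size_pos k ω)).symm

/-- The norm condition, integrated over an event of the past. -/
lemma Sampling.setIntegral_estVar_div_le (hd : 1 ≤ d) (h : Sampling μ P m T S)
    (hf : WellPosed P f) (hs : Smoothness P f Lf Mf) (hvar : BoundedVariance P f) (hν : 0 < ν)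
    {θ : ℝ} {k : ℕ} (hnorm : NormCondition μ P m f ν α T S x₀ θ k) {B : Set Ω}
    (hB : MeasurableSet[past T S k] B) :
    Integrable (fun ω => estVar P f ν (scaling m d (N k))
      (iter m f ν α T S x₀ k ω, T k ω) / ((S k ω).1 : ℝ)) μ ∧
    ∫ ω in B, estVar P f ν (scaling m d (N k))
        (iter m f ν α T S x₀ k ω, T k ω) / ((S k ω).1 : ℝ) ∂μ
      ≤ θ ^ 2 * ∫ ω in B, ‖gradEst (objective P f) ν (scaling m d (N k)) (T k ω)
        (iter m f ν α T S x₀ k ω)‖ ^ 2 ∂μ := by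
  set V := fun ω => estVar P f ν (scaling m d (N k)) (iter m f ν α T S x₀ k ω, T k ω) with hV
  set G := fun ω => ‖gradEst (objective P f) ν (scaling m d (N k)) (T k ω)
        (iter m f ν α T S x₀ k ω)‖ ^ 2 with hG
  obtain ⟨hGi, hVi⟩ := h.integrable_norm_gradEst_objective_sq (α := α) (x₀ := x₀) hd hf hs hvar hν k
  have hle := h.past_le k
  have hgT := h.gT_ae_eq (α := α) (x₀ := x₀) hd hf hs hvar hν k
  have hninv : Measurable[past T S k] fun ω => ((S k ω).1 : ℝ)⁻¹ :=
    (measurable_from_nat (f := fun n : ℕ => (n : ℝ)⁻¹)).comp (h.size_past k)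
  have hVn : Integrable (fun ω => V ω * ((S k ω).1 : ℝ)⁻¹) μ := by
    refine hVi.mono' (hVi.1.mul (hninv.mono hle le_rfl).aestronglyMeasurable)
      (.of_forall fun ω => ?_)
    have h0 : 0 ≤ V ω := estVar_nonneg ν _ _
    rw [Real.norm_of_nonneg (by positivity)]
    refine mul_le_of_le_one_right h0 (inv_le_one_of_one_le₀ ?_)
    exact_mod_cast h.size_pos k ω
  simp only [div_eq_mul_inv]
  refine ⟨hVn, ?_⟩
  have hcV : μ[fun ω' => ∫ ζ, ‖gradEst (fun y => f y ζ) ν (scaling m d (N k)) (T k ω')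
      (iter m f ν α T S x₀ k ω') - gT μ m f ν α T S x₀ k ω'‖ ^ 2 ∂P | past T S k]
      =ᵐ[μ] μ[V | past T S k] := by
    refine condExp_congr_ae ?_
    filter_upwards [hgT] with ω hω
    rw [hω]
    rfl
  have hcG : μ[fun ω' => ‖gT μ m f ν α T S x₀ k ω'‖ ^ 2 | past T S k]
      =ᵐ[μ] μ[G | past T S k] := by
    refine condExp_congr_ae ?_
    filter_upwards [hgT] with ω hω
    rw [hω]
  -- The sample size is determined by the past, so its inverse can be moved into the conditional
  -- expectation.
  have hpull : μ[fun ω => V ω * ((S k ω).1 : ℝ)⁻¹ | past T S k]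
      =ᵐ[μ] fun ω => (μ[V | past T S k]) ω * ((S k ω).1 : ℝ)⁻¹ :=
    condExp_mul_of_stronglyMeasurable_right hninv.stronglyMeasurable hVn hVi
  have hmono : ∀ᵐ ω ∂μ, (μ[fun ω => V ω * ((S k ω).1 : ℝ)⁻¹ | past T S k]) ω
      ≤ θ ^ 2 * (μ[G | past T S k]) ω := by
    filter_upwards [hnorm, hcV, hcG, hpull] with ω h1 h2 h3 h4
    rw [h2, h3, div_eq_mul_inv] at h1
    rw [h4]
    exact h1
  rw [← setIntegral_condExp hle hVn hB, ← setIntegral_condExp hle hGi hB, ← integral_const_mul]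
  exact setIntegral_mono_ae integrable_condExp.integrableOn
    (integrable_condExp.const_mul _).integrableOn hmono

/-- A conditional expectation is bounded by a measurable function if its integrals over the
events of the σ-algebra are. -/
lemma condExp_ae_le_of_setIntegral_le {𝓖 : MeasurableSpace Ω} (h𝓖 : 𝓖 ≤ mΩ) {g r : Ω → ℝ}
    (hg : Integrable g μ) (hr : Integrable r μ) (hrm : Measurable[𝓖] r)
    (hle : ∀ B, MeasurableSet[𝓖] B → ∫ ω in B, g ω ∂μ ≤ ∫ ω in B, r ω ∂μ) :
    μ[g | 𝓖] ≤ᵐ[μ] r := by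
  have hcm : StronglyMeasurable[𝓖] (μ[g | 𝓖]) := stronglyMeasurable_condExp
  -- On the measure trimmed to `𝓖` all measurable sets lie in `𝓖`, and the comparison of set
  -- integrals applies.
  refine ae_le_of_ae_le_trim (hm := h𝓖) ?_
  refine ae_le_of_forall_setIntegral_le (integrable_condExp.trim h𝓖 hcm)
    (hr.trim h𝓖 hrm.stronglyMeasurable) fun B hB _ => ?_
  rw [← setIntegral_trim h𝓖 hcm hB, ← setIntegral_trim h𝓖 hrm.stronglyMeasurable hB,
    setIntegral_condExp h𝓖 hg hB]
  exact hle B hB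

/-- The expected decrease over the directions at a fixed point. -/
lemma integral_directions_le (hd : 1 ≤ d) (hs : Smoothness P f Lf Mf) (hν : 0 < ν) {n : ℕ}
    (hn : 1 ≤ n) {τ : Measure (Fin n → Vec d)} [IsProbabilityMeasure τ] (hτ : IsDirectionLaw m τ)
    {MF : ℝ} (hMF : HessLipschitz (objective P f) MF) (x : Vec d) :
    ∫ u, (-inner ℝ (gradient (objective P f) x) (gradEst (objective P f) ν (scaling m d n) u x)
        + stepFactor m d n / 8 * ‖gradEst (objective P f) ν (scaling m d n) u x‖ ^ 2) ∂τ
      ≤ -(1 / 4) * ‖gradient (objective P f) x‖ ^ 2 + chi m d n MF ν := by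
  have hM := hMF.nonneg hd
  have hC := hs.contDiff_objective
  simp only [gradEst_eq_sum_dirTerm]
  exact hτ.integral_descent_le hd hn hM (continuous_diffErr hC ν x)
    (fun u => hMF.abs_diffErr_le hC hν x u)
    (fun u u' hu => hMF.abs_diffErr_sub_le hC hM hν x hu) _

/-- The descent inequality, integrated over an event of the past. -/
lemma Sampling.setIntegral_objective_le (hd : 1 ≤ d) (hN : ∀ k, 1 ≤ N k) (h : Sampling μ P m T S)
    (hf : WellPosed P f) (hs : Smoothness P f Lf Mf) (hvar : BoundedVariance P f) (hν : 0 < ν)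
    {θ LF MF : ℝ} (hLF0 : 0 < LF) (hLF : GradLipschitz (objective P f) LF)
    (hMF : HessLipschitz (objective P f) MF) {k : ℕ}
    (hnorm : NormCondition μ P m f ν α T S x₀ θ k) (hα : 0 < α k)
    (hα' : α k ≤ alphaBar m d (N k) θ LF) {B : Set Ω} (hB : MeasurableSet[past T S k] B) :
    ∫ ω in B, objective P f (iter m f ν α T S x₀ (k + 1) ω) ∂μ
      ≤ ∫ ω in B, (objective P f (iter m f ν α T S x₀ k ω)
        - α k / 4 * ‖gradient (objective P f) (iter m f ν α T S x₀ k ω)‖ ^ 2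
        + α k * chi m d (N k) MF ν) ∂μ := by
  set F := objective P f with hF
  set X := iter m f ν α T S x₀ k with hX
  set γ := scaling m d (N k) with hγ
  set a := α k with ha
  set c := stepFactor m d (N k) with hc
  have hFC : ContDiff ℝ 2 F := hs.contDiff_objective
  have hle := h.past_le k
  -- Events of the past also belong to `pastHalf`, so the sample can be averaged out over `B` before
  -- the directions.
  have hBm : MeasurableSet[pastHalf T S k] B := le_sup_left (a := past T S k) B hB
  obtain ⟨C, hC, hb⟩ := exists_integral_norm_gradEst_sq_le (N := N k) hd hf hs hvar hν γ
  have hcont : ∀ ζ, Continuous fun x => f x ζ := fun ζ => (hs.contDiff ζ).continuous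
  have hXp : Measurable[past T S k] X := measurable_iter hf hs k
  have hXm : Measurable X := hXp.mono hle le_rfl
  have hX2 : Integrable (fun ω => ‖X ω‖ ^ 2) μ := h.integrable_norm_iter_sq hd hf hs hvar hν k
  have hX2' := h.integrable_norm_iter_sq (α := α) (x₀ := x₀) hd hf hs hvar hν (k + 1)
  have hXm' : Measurable (iter m f ν α T S x₀ (k + 1)) :=
    (measurable_iter hf hs (k + 1)).mono (h.past_le _) le_rfl
  have hFi : Integrable (fun ω => F (X ω)) μ := hLF.integrable_comp hFC hXm hX2
  have hFi' := hLF.integrable_comp hFC hXm' hX2'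
  have hgm : Measurable (gradient F) := (contDiff_gradient hFC).continuous.measurable
  have hg2 : Integrable (fun ω => ‖gradient F (X ω)‖ ^ 2) μ :=
    hLF.integrable_norm_gradient_sq hd hFC hXm hX2
  have hT := h.measurable_T k
  have hY := h.measurable_iterData (α := α) (x₀ := x₀) (ν := ν) hf hs k
  set e := fun ω => gradEst (subsampled f (S k ω)) ν γ (T k ω) (X ω) with he
  set G := fun ω => gradEst F ν γ (T k ω) (X ω) with hGdef
  set V := fun ω => estVar P f ν γ (X ω, T k ω) with hVdef
  have hΦe : Measurable fun p : ((Vec d × (Fin (N k) → Vec d)) × ℕ) × Sample Ξ =>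
      gradEst (subsampled f p.2) ν γ p.1.1.2 p.1.1.1 :=
    hs.measurable_gradEst_iterData hf (N k) ν γ
  have hem : Measurable e := by
    have hc := hΦe.comp ((hY.mono (h.pastHalf_le k) le_rfl).prodMk (h.measurable_S k))
    exact hc
  have he2 : Integrable (fun ω => ‖e ω‖ ^ 2) μ := h.integrable_norm_gradEst_sq hd hf hs hvar hν k hX2
  have hΨG : Measurable fun p : Vec d × (Fin (N k) → Vec d) => gradEst F ν γ p.2 p.1 :=
    measurable_gradEst_apply hFC.continuous ν γ
  have hGm : Measurable G := hΨG.comp (hXm.prodMk hT)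
  obtain ⟨hG2, hVi⟩ : Integrable (fun ω => ‖G ω‖ ^ 2) μ ∧ Integrable V μ :=
    h.integrable_norm_gradEst_objective_sq hd hf hs hvar hν k
  have hgXm : Measurable fun ω => gradient F (X ω) := hgm.comp hXm
  have hge : Integrable (fun ω => inner ℝ (gradient F (X ω)) (e ω)) μ :=
    integrable_inner_of_sq hgXm hem hg2 he2
  have hgG : Integrable (fun ω => inner ℝ (gradient F (X ω)) (G ω)) μ :=
    integrable_inner_of_sq hgXm hGm hg2 hG2
  obtain ⟨hVn, hVle⟩ := h.setIntegral_estVar_div_le hd hf hs hvar hν hnorm hB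
  change Integrable (fun ω => V ω / ((S k ω).1 : ℝ)) μ at hVn
  change ∫ ω in B, V ω / ((S k ω).1 : ℝ) ∂μ ≤ θ ^ 2 * ∫ ω in B, ‖G ω‖ ^ 2 ∂μ at hVle
  -- the descent lemma along the step
  have hstep : ∀ ω, F (iter m f ν α T S x₀ (k + 1) ω)
      ≤ F (X ω) + (-a) * inner ℝ (gradient F (X ω)) (e ω) + LF * a ^ 2 / 2 * ‖e ω‖ ^ 2 := by
    intro ω
    have h1 := (abs_le.1 (hLF.abs_sub_le hFC (X ω) (-(a • e ω)))).2
    rw [norm_neg, norm_smul, mul_pow, Real.norm_eq_abs, sq_abs, inner_neg_right,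
      inner_smul_right, ← sub_eq_add_neg] at h1
    change F (X ω - a • e ω) ≤ _
    linarith
  have hΨ1i : Integrable (fun ω => F (X ω) + (-a) * inner ℝ (gradient F (X ω)) (e ω)
      + LF * a ^ 2 / 2 * ‖e ω‖ ^ 2) μ := (hFi.add (hge.const_mul _)).add (he2.const_mul _)
  -- averaging over the sample
  have hsample : ∫ ω in B, (F (X ω) + (-a) * inner ℝ (gradient F (X ω)) (e ω)
      + LF * a ^ 2 / 2 * ‖e ω‖ ^ 2) ∂μ
      = ∫ ω in B, (F (X ω) + (-a) * inner ℝ (gradient F (X ω)) (G ω)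
      + LF * a ^ 2 / 2 * (‖G ω‖ ^ 2 + V ω / ((S k ω).1 : ℝ))) ∂μ := by
    have hΦ : Measurable fun p : ((Vec d × (Fin (N k) → Vec d)) × ℕ) × Sample Ξ =>
        F p.1.1.1 + (-a) * inner ℝ (gradient F p.1.1.1)
          (gradEst (subsampled f p.2) ν γ p.1.1.2 p.1.1.1)
          + LF * a ^ 2 / 2 * ‖gradEst (subsampled f p.2) ν γ p.1.1.2 p.1.1.1‖ ^ 2 := by
      have h1 : Measurable fun p : ((Vec d × (Fin (N k) → Vec d)) × ℕ) × Sample Ξ => p.1.1.1 :=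
        measurable_fst.fst.fst
      exact ((hFC.continuous.measurable.comp h1).add
        (((hgm.comp h1).inner hΦe).const_mul _)).add ((hΦe.norm.pow_const 2).const_mul _)
    refine (h.setIntegral_eq k hBm hY measurable_snd (fun _ => rfl) hΦ.stronglyMeasurable
      hΨ1i).trans ?_
    congr 1
    ext1 ω
    have hw := (hb (X ω) (T k ω)).1
    obtain ⟨hi1, hi2⟩ := integrable_sampleKernel_gradEst hcont hf.measurable hw (S k ω).1
    change ∫ s, (F (X ω) + (-a) * inner ℝ (gradient F (X ω))
          (gradEst (subsampled f s) ν γ (T k ω) (X ω))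
          + LF * a ^ 2 / 2 * ‖gradEst (subsampled f s) ν γ (T k ω) (X ω)‖ ^ 2)
          ∂(sampleKernel P (S k ω).1) = _
    have hi3 : Integrable (fun s => F (X ω) + (-a) * inner ℝ (gradient F (X ω))
          (gradEst (subsampled f s) ν γ (T k ω) (X ω))) (sampleKernel P (S k ω).1) :=
      (integrable_const _).add ((hi1.const_inner _).const_mul _)
    rw [integral_add hi3 (hi2.const_mul _), integral_add (integrable_const _)
      ((hi1.const_inner _).const_mul _), integral_const_mul, integral_const_mul,
      integral_inner hi1, integral_sampleKernel_gradEst hf hcont hw (h.size_pos k ω),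
      integral_sampleKernel_norm_gradEst_sq hf hcont hw (h.size_pos k ω)]
    simp only [integral_const, probReal_univ, one_smul]
    rfl
  -- averaging over the directions
  set Ψ := fun p : Vec d × (Fin (N k) → Vec d) =>
    -inner ℝ (gradient F p.1) (gradEst F ν γ p.2 p.1) + c / 8 * ‖gradEst F ν γ p.2 p.1‖ ^ 2 with hΨ
  have hΨm : Measurable Ψ :=
    ((hgm.comp measurable_fst).inner hΨG).neg.add ((hΨG.norm.pow_const 2).const_mul _)
  have hΨi : Integrable (fun ω => Ψ (X ω, T k ω)) μ := hgG.neg.add (hG2.const_mul _)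
  have hτp := Measure.isProbabilityMeasure_map (μ := μ) hT.aemeasurable
  obtain ⟨hdir, hdiri⟩ := h.setIntegral_directions_eq k hB hXp hΨm hΨi
  have hχ : Integrable (fun ω => -(1 / 4) * ‖gradient F (X ω)‖ ^ 2 + chi m d (N k) MF ν) μ :=
    (hg2.const_mul _).add (integrable_const _)
  have hdirle : ∫ ω in B, Ψ (X ω, T k ω) ∂μ
      ≤ ∫ ω in B, (-(1 / 4) * ‖gradient F (X ω)‖ ^ 2 + chi m d (N k) MF ν) ∂μ := by
    rw [hdir]
    exact setIntegral_mono hdiri.integrableOn hχ.integrableOn fun ω =>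
      integral_directions_le hd hs hν (hN k) (h.law_T k) hMF (X ω)
  -- the step size restriction
  have hsize : LF * a ^ 2 / 2 * (1 + θ ^ 2) ≤ a * (c / 8) := by
    rw [alphaBar_eq, ← hc, Omega₁, mul_one_div, le_div_iff₀ (by positivity)] at hα'
    nlinarith
  have hG2B : 0 ≤ ∫ ω in B, ‖G ω‖ ^ 2 ∂μ := integral_nonneg fun _ => by positivity
  calc ∫ ω in B, F (iter m f ν α T S x₀ (k + 1) ω) ∂μ
      ≤ ∫ ω in B, (F (X ω) + (-a) * inner ℝ (gradient F (X ω)) (e ω)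
          + LF * a ^ 2 / 2 * ‖e ω‖ ^ 2) ∂μ :=
        setIntegral_mono hFi'.integrableOn hΨ1i.integrableOn hstep
    _ = ∫ ω in B, (F (X ω) + (-a) * inner ℝ (gradient F (X ω)) (G ω)
          + LF * a ^ 2 / 2 * (‖G ω‖ ^ 2 + V ω / ((S k ω).1 : ℝ))) ∂μ := hsample
    _ = ∫ ω in B, F (X ω) ∂μ + (-a) * ∫ ω in B, inner ℝ (gradient F (X ω)) (G ω) ∂μ
          + LF * a ^ 2 / 2 * (∫ ω in B, ‖G ω‖ ^ 2 ∂μ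
            + ∫ ω in B, V ω / ((S k ω).1 : ℝ) ∂μ) := by
        have h1 : IntegrableOn (fun ω => F (X ω) + (-a) * inner ℝ (gradient F (X ω)) (G ω)) B μ :=
          (hFi.add (hgG.const_mul _)).integrableOn
        have h2 : IntegrableOn (fun ω => ‖G ω‖ ^ 2 + V ω / ((S k ω).1 : ℝ)) B μ :=
          (hG2.add hVn).integrableOn
        rw [integral_add h1 (h2.const_mul _), integral_add hFi.integrableOn
          (hgG.integrableOn.const_mul _), integral_const_mul, integral_const_mul,
          integral_add hG2.integrableOn hVn.integrableOn]
    -- The norm condition trades the variance for `θ²` times the second moment of `G`, and `hsize`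
    -- absorbs the resulting factor `1 + θ²`.
    _ ≤ ∫ ω in B, F (X ω) ∂μ + a * (-(∫ ω in B, inner ℝ (gradient F (X ω)) (G ω) ∂μ)
          + c / 8 * ∫ ω in B, ‖G ω‖ ^ 2 ∂μ) := by
        have h1 := mul_le_mul_of_nonneg_right hsize hG2B
        have h2 := mul_le_mul_of_nonneg_left hVle (by positivity : 0 ≤ LF * a ^ 2 / 2)
        linarith
    _ = ∫ ω in B, F (X ω) ∂μ + a * ∫ ω in B, Ψ (X ω, T k ω) ∂μ := by
        have h1 : IntegrableOn (fun ω => -inner ℝ (gradient F (X ω)) (G ω)) B μ :=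
          hgG.neg.integrableOn
        have h2 : ∫ ω in B, Ψ (X ω, T k ω) ∂μ
            = ∫ ω in B, (-inner ℝ (gradient F (X ω)) (G ω) + c / 8 * ‖G ω‖ ^ 2) ∂μ := rfl
        rw [h2, integral_add h1 (hG2.integrableOn.const_mul _), integral_neg, integral_const_mul]
    _ ≤ ∫ ω in B, F (X ω) ∂μ
          + a * ∫ ω in B, (-(1 / 4) * ‖gradient F (X ω)‖ ^ 2 + chi m d (N k) MF ν) ∂μ := by
        gcongr
    _ = _ := by
        rw [← integral_const_mul, ← integral_add hFi.integrableOn (hχ.integrableOn.const_mul _)]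
        congr 1
        ext1 ω
        ring

end Descent

end CFD


theorem lemma1 {Ω Ξ : Type*} [MeasurableSpace Ω] [MeasurableSpace Ξ]
    (μ : MeasureTheory.Measure Ω) [MeasureTheory.IsProbabilityMeasure μ]
    (P : MeasureTheory.Measure Ξ) [MeasureTheory.IsProbabilityMeasure P]
    (m : CFD.Scheme) {d : ℕ} (hd : 1 ≤ d)
    (f : CFD.Vec d → Ξ → ℝ) (Lf Mf : ℝ)
    (hf : CFD.WellPosed P f) (hsmooth : CFD.Smoothness P f Lf Mf)
    (hvar : CFD.BoundedVariance P f)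
    (ν : ℝ) (hν : 0 < ν) (θ : ℝ) (hθ : 0 < θ)
    (N : ℕ → ℕ) (hN : ∀ k, 1 ≤ N k)
    (T : (k : ℕ) → Ω → Fin (N k) → CFD.Vec d) (S : ℕ → Ω → CFD.Sample Ξ)
    (hsampling : CFD.Sampling μ P m T S)
    (α : ℕ → ℝ) (x₀ : CFD.Vec d) :
    -- `F` inherits the Lipschitz constants of the functions `f(·, ζ)`
    (CFD.GradLipschitz (CFD.objective P f) Lf ∧ CFD.HessLipschitz (CFD.objective P f) Mf) ∧
    -- the descent inequality, for all Lipschitz constants `LF`, `MF` of `∇F`, `∇²F`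
    ∀ LF MF : ℝ, 0 < LF → CFD.GradLipschitz (CFD.objective P f) LF →
      CFD.HessLipschitz (CFD.objective P f) MF →
      ∀ k : ℕ, CFD.NormCondition μ P m f ν α T S x₀ θ k →
        0 < CFD.alphaBar m d (N k) θ LF ∧
        (0 < MF → 0 < CFD.chi m d (N k) MF ν) ∧
        (0 < α k → α k ≤ CFD.alphaBar m d (N k) θ LF →
          MeasureTheory.Integrable
            (fun ω => CFD.objective P f (CFD.iter m f ν α T S x₀ (k + 1) ω)) μ ∧
          μ[fun ω => CFD.objective P f (CFD.iter m f ν α T S x₀ (k + 1) ω) | CFD.past T S k]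
            ≤ᵐ[μ] fun ω =>
              CFD.objective P f (CFD.iter m f ν α T S x₀ k ω)
                - α k / 4 * ‖gradient (CFD.objective P f) (CFD.iter m f ν α T S x₀ k ω)‖ ^ 2
                + α k * CFD.chi m d (N k) MF ν) := by
  have hLFobj := hsmooth.gradLipschitz_objective hd hf
  refine ⟨⟨hLFobj, hsmooth.hessLipschitz_objective hd hf⟩, ?_⟩
  intro LF MF hLF0 hLF hMF k hnorm
  refine ⟨CFD.alphaBar_pos m hd (hN k) θ hLF0, fun hMF0 => CFD.chi_pos m hd (hN k) hMF0 hν,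
    fun hα hα' => ?_⟩
  have hC := hsmooth.contDiff_objective
  have hXp : Measurable[CFD.past T S k] (CFD.iter m f ν α T S x₀ k) :=
    CFD.measurable_iter hf hsmooth k
  have hX := hXp.mono (hsampling.past_le k) le_rfl
  have hX' : Measurable (CFD.iter m f ν α T S x₀ (k + 1)) :=
    (CFD.measurable_iter hf hsmooth (k + 1)).mono (hsampling.past_le (k + 1)) le_rfl
  have hX2 := hsampling.integrable_norm_iter_sq (α := α) (x₀ := x₀) hd hf hsmooth hvar hν k
  have hFi' := hLF.integrable_comp hC hX'
    (hsampling.integrable_norm_iter_sq (α := α) (x₀ := x₀) hd hf hsmooth hvar hν (k + 1))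
  -- The right-hand side is a measurable function of the current iterate, hence of the past, so the
  -- conditional inequality follows from its integrals over events of the past.
  refine ⟨hFi', CFD.condExp_ae_le_of_setIntegral_le (hsampling.past_le k) hFi' ?_ ?_
    fun B hB => hsampling.setIntegral_objective_le hd hN hf hsmooth hvar hν hLF0 hLF hMF hnorm
      hα hα' hB⟩
  · exact ((hLF.integrable_comp hC hX hX2).sub
      ((hLF.integrable_norm_gradient_sq hd hC hX hX2).const_mul _)).add
        (MeasureTheory.integrable_const _)
  · have hg : Measurable (gradient (CFD.objective P f)) :=
      (CFD.contDiff_gradient hC).continuous.measurable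
    have h1 : Measurable fun x => CFD.objective P f x
        - α k / 4 * ‖gradient (CFD.objective P f) x‖ ^ 2 + α k * CFD.chi m d (N k) MF ν :=
      (hC.continuous.measurable.sub ((hg.norm.pow_const 2).const_mul _)).add_const _
    exact h1.comp hXp
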